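/- Let $S^1=\mathbb R/\mathbb Z$ be the circle of unit length, the class of $\theta$ standing for $e^{2\pi i\theta}$, and let $|x-y|\in[0,1/2]$ be the distance of $x,y\in S^1$. For $\nu,\sigma,\alpha>0$ the Matérn covariogram on $S^1$ is $$k_{\nu,\sigma,\alpha}(x,y)=\frac{\sigma^2\sum_{n\in\mathbb Z}(\alpha^2+4\pi^2n^2)^{-\nu-1/2}\cos(2\pi n(x-y))}{\sum_{n\in\mathbb Z}(\alpha^2+4\pi^2n^2)^{-\nu-1/2}},$$ so that $k_{\nu,\sigma,\alpha}(x,x)=\sigma^2$. The Matérn measure with parameters $(\nu,\sigma^2,\alpha)$ is the law $P$, on $\mathbb R^{S^1}$ with the product $\sigma$-algebra, of a zero-mean Gaussian process on $S^1$ with covariance $k_{\nu,\sigma,\alpha}$. Two measures are equivalent, $P_1\equiv P_2$, if each is absolutely continuous with respect to the other. For $s\in\mathbb N=\{0,1,2,\dots\}$ and $\alpha>0$ define $$F_{s,\alpha}(u)=\sum_{k=0}^s a_{s,k}\,v^k\,\mathrm{hyp}^k(v),\quad v=\alpha(u-1/2),\qquad C_{1/2+s,\alpha}=F_{s,\alpha}(0)=\sum_{k=0}^s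 a_{s,k}(-\alpha/2)^k\,\mathrm{hyp}^k(-\alpha/2),$$ where $\mathrm{hyp}^k$ is $\cosh$ for even $k$ and $\sinh$ for odd $k$, and the constants $a_{s,k}=a_{s,k}(\alpha)$ are given by $a_{0,0}=1$, $$a_{s+1,j+1}=-\frac{2\pi^2}{\alpha^2\,(j+1)!}\sum_{i=j}^{s}\left(-\tfrac12\right)^{i-j} i!\,a_{s,i}\quad(0\le j\le s),$$ $$a_{s+1,0}=-\frac{1}{\sinh(\alpha/2)}\sum_{k=1}^{s+1}a_{s+1,k}\left(k(\alpha/2)^{k-1}\mathrm{hyp}^k(\alpha/2)+(\alpha/2)^{k}\,\mathrm{hyp}^{k+1}(\alpha/2)\right);$$ equivalently, $F_{0,\alpha}(u)=\cosh(\alpha(u-1/2))$, $\alpha^2F_{s+1,\alpha}-F_{s+1,\alpha}''=4\pi^2F_{s,\alpha}$ and $F_{s+1,\alpha}'(0)=F_{s+1,\alpha}'(1)=0$. Let $s\in\mathbb N$ and $\nu=1/2+s$. Then $C_{\nu,\alpha}$ is the normalising constant of the closed form of the covariogram: for all $\sigma,\alpha>0$ and $x,y\in S^1$, $$k_{\nu,\sigma,\alpha}(x,y)=\frac{\sigma^2}{C_{\nu,\alpha}}F_{s,\alpha}(|x-y|).$$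 If $P_i$ is the Matérn measure with parameters $(\nu,\sigma_i^2,\alpha_i)$, $\sigma_i,\alpha_i>0$, $i=1,2$, then $$P_1\equiv P_2\quad\Longleftrightarrow\quad \frac{\sigma_1^2\alpha_1\sinh(\alpha_1/2)}{C_{\nu,\alpha_1}}=\frac{\sigma_2^2\alpha_2\sinh(\alpha_2/2)}{C_{\nu,\alpha_2}}.$$ Moreover neither $\sigma^2$ nor $\alpha$ can be consistently estimated: with $\nu$ known, there is no sequence $(T_n)$ of measurable functions of the path (in particular no sequence of measurable functions of finitely many observations $Z(x_1),\dots,Z(x_n)$) such that for all $\sigma,\alpha>0$, $T_n\to\sigma^2$ in probability under the Matérn measure with parameters $(\nu,\sigma^2,\alpha)$; and there is none such that for all $\sigma,\alpha>0$, $T_n\to\alpha$ in probability under that measure. -/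

import Mathlib

open MeasureTheory ProbabilityTheory Filter

namespace MaternCircle

/-! The circle of unit length is `UnitAddCircle = ℝ / ℤ`, the class of `θ` standing for the point
`exp (2 π i θ)`.  The eigenvalues of the negative Laplacian are `4 π² n²`, `n ∈ ℤ`, with
eigenfunctions `fourier n`. -/

/-- The unnormalised Matérn spectral weight `(α² + 4 π² n²) ^ (-ν - 1/2)` at frequency `n`. -/
noncomputable def spectralWeight (ν α : ℝ) (n : ℤ) : ℝ :=
  (α ^ 2 + 4 * Real.pi ^ 2 * (n : ℝ) ^ 2) ^ (-ν - 1 / 2)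

/-- The Matérn covariogram on the circle with smoothness `ν`, decay `α` and variance `σ²`:
the spectral series `∑ₙ (α² + 4 π² n²) ^ (-ν - 1/2) eₙ(x) conj(eₙ(y))`, `eₙ = fourier n`,
scaled so that the variance `k(x, x)` is `σ²`.  The summand is
`(α² + 4 π² n²) ^ (-ν - 1/2) cos (2 π n (x - y))`. -/
noncomputable def covariogram (ν σ α : ℝ) (x y : UnitAddCircle) : ℝ :=
  σ ^ 2 / (∑' n : ℤ, spectralWeight ν α n) *
    ∑' n : ℤ, spectralWeight ν α n * (fourier n (x - y)).re

/-- `P` is the law on path space (with the product σ-algebra) of a zero-mean Gaussian process on the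
circle with covariance function `k`. -/
structure IsCenteredGaussianLaw (k : UnitAddCircle → UnitAddCircle → ℝ)
    (P : Measure (UnitAddCircle → ℝ)) : Prop where
  gaussian : IsGaussianProcess (fun (x : UnitAddCircle) (z : UnitAddCircle → ℝ) => z x) P
  mean_zero : ∀ x : UnitAddCircle, ∫ z, z x ∂P = 0
  covariance_eq : ∀ x y : UnitAddCircle,
    covariance (fun z : UnitAddCircle → ℝ => z x) (fun z : UnitAddCircle → ℝ => z y) P = k x y

/-- `P` is the Matérn Gaussian measure on the circle with parameters `ν, σ², α`. -/
def IsMaternMeasure (ν σ α : ℝ) (P : Measure (UnitAddCircle → ℝ)) : Prop :=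
  IsCenteredGaussianLaw (covariogram ν σ α) P

/-- Equivalence of measures: mutual absolute continuity. -/
def Equivalent {Ω : Type*} [MeasurableSpace Ω] (P Q : Measure Ω) : Prop :=
  P ≪ Q ∧ Q ≪ P

/-- `cosh` for even `k` and `sinh` for odd `k`. -/
noncomputable def hyp (k : ℕ) (v : ℝ) : ℝ :=
  if Even k then Real.cosh v else Real.sinh v

/-- The coefficient of index `j + 1` at level `s + 1`, from the coefficients `a` of level `s`. -/
noncomputable def nextHigherCoeff (α : ℝ) (s : ℕ) (a : ℕ → ℝ) (j : ℕ) : ℝ :=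
  -(2 * Real.pi ^ 2 / α ^ 2) / ((j + 1).factorial : ℝ) *
    ∑ i ∈ Finset.Icc j s, (-1 / 2 : ℝ) ^ (i - j) * (i.factorial : ℝ) * a i

/-- All coefficients of level `s + 1` from the coefficients `a` of level `s`.  The coefficient of
index `0` makes the derivative of `v ↦ ∑ₖ bₖ vᵏ hypᵏ(v)` vanish at `v = α / 2`. -/
noncomputable def nextCoeff (α : ℝ) (s : ℕ) (a : ℕ → ℝ) : ℕ → ℝ
  | 0 => -(∑ j ∈ Finset.range (s + 1), nextHigherCoeff α s a j *
      (((j : ℝ) + 1) * (α / 2) ^ j * hyp (j + 1) (α / 2) +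
        (α / 2) ^ (j + 1) * hyp (j + 2) (α / 2))) / Real.sinh (α / 2)
  | j + 1 => nextHigherCoeff α s a j

/-- The coefficients `a_{s,k}` of the closed form of the Matérn covariogram with `ν = 1/2 + s`.
They are those for which the profiles `F_s(u) = ∑ₖ a_{s,k} vᵏ hypᵏ(v)`, `v = α (u - 1/2)`, satisfy
`F_0 = cosh v`, `α² F_{s+1} - F_{s+1}'' = 4 π² F_s` and `F_{s+1}'(0) = F_{s+1}'(1) = 0`. -/
noncomputable def coeff (α : ℝ) : ℕ → ℕ → ℝ
  | 0 => fun k => if k = 0 then 1 else 0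
  | s + 1 => nextCoeff α s (coeff α s)

/-- The profile `∑_{k=0}^s a_{s,k} (α (u - 1/2))ᵏ hypᵏ(α (u - 1/2))`. -/
noncomputable def profile (s : ℕ) (α u : ℝ) : ℝ :=
  ∑ k ∈ Finset.range (s + 1), coeff α s k * (α * (u - 1 / 2)) ^ k * hyp k (α * (u - 1 / 2))

/-- The normalising constant `C_{ν,α}`, `ν = 1/2 + s`, of the closed form. -/
noncomputable def normConst (s : ℕ) (α : ℝ) : ℝ :=
  ∑ k ∈ Finset.range (s + 1), coeff α s k * (-α / 2) ^ k * hyp k (-α / 2)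

/-- `T` is a (weakly) consistent sequence of estimators of the parameter `g σ α`, when `ν` is known
and `σ, α > 0` are unknown.  Estimators are measurable functions of the whole path; those that use
only finitely many observations of the path are a special case. -/
def IsConsistent (ν : ℝ) (T : ℕ → (UnitAddCircle → ℝ) → ℝ) (g : ℝ → ℝ → ℝ) : Prop :=
  (∀ n, Measurable (T n)) ∧
    ∀ σ α : ℝ, 0 < σ → 0 < α → ∀ P : Measure (UnitAddCircle → ℝ), IsMaternMeasure ν σ α P →
      TendstoInMeasure P T atTop (fun _ => g σ α)

end MaternCircle

/-!
The Matérn measures are laws of random Fourier series, and all three claims follow from the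
spectrum of the covariogram.

*Closed form.*  The recurrence for the coefficients says that the profiles satisfy
`α² F_{s+1} - F_{s+1}'' = 4 π² F_s` with vanishing derivatives at the end points
(`hypSumDefect_nextCoeff`, `hypSumDeriv_nextCoeff`).  Integrating twice by parts, each step divides
the `n`-th Fourier coefficient by `α² + 4 π² n²`, up to the factor `4 π²`, so the coefficient of
`F_s` is `(4 π²)^s · 2 α sinh (α / 2) · (α² + 4 π² n²)^(-s-1)`
(`integral_fourier_mul_profile`).  The Fourier series of the profile is therefore a multiple of the
series defining the covariogram, and `normConst_eq` computes the normalising constant.  In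
particular the quantity `σ² α sinh (α / 2) / C` is a fixed multiple of
`σ² / ∑ₙ (α² + 4 π² n²)^(-s-1)`, the factor in front of the spectral weights (`spectralScale`).

*Reduction to sequences.*  Expand in the real orthonormal basis `cas n = cos + sin`, `n ∈ ℤ`.  For
independent centred Gaussian coefficients with summable variances, the random series converges in
`L²` at each point and defines a Gaussian process whose covariance is the one of the given
spectrum.  By uniqueness of Fourier coefficients, each coefficient lies in the closed span of the
values of the process, so it is almost surely a measurable function of the path.  One pair of maps
between coefficients and paths serves two given spectra (`exists_representation`).  As centred
Gaussian laws are determined by their covariance, absolute continuity of Matérn measures is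
absolute continuity of product measures `⨂ₙ N(0, vₙ)`
(`absolutelyContinuous_iff_gaussianSeq`).

*Product measures.*  If `∑ |vₙ / wₙ - 1| < ∞`, the logarithms of the density ratios have summable
`L¹` norms.  Markov's inequality then yields `⨂ N(0, vₙ) ≪ ⨂ N(0, wₙ)`, first as a quantitative
bound on cylinders and then by approximation (`infinitePi_absolutelyContinuous`).  Two Matérn
spectra with the same factor satisfy this condition, because their ratio is `1 + O(n⁻²)`.
Conversely the strong law of large numbers for the normalised squared coefficients recovers the
factor, so different factors give measures that are not absolutely continuous.

*Estimation.*  Under equivalent measures a sequence of estimators has only one limit in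
probability, so every consistently estimable parameter is a function of the factor.  Along
`σ² = ∑ₙ (α² + 4 π² n²)^(-s-1)` the factor is constant while both `α` and `σ²` vary.
-/

namespace MaternCircle

/-! ### Hyperbolic sums and their differential equation -/

lemma hyp_add_two (k : ℕ) : hyp (k + 2) = hyp k := by
  funext v
  simp [hyp, Nat.even_add]

lemma hasDerivAt_hyp (k : ℕ) (v : ℝ) : HasDerivAt (hyp k) (hyp (k + 1) v) v := by
  rcases Nat.even_or_odd k with h | h
  · have h1 : hyp k = Real.cosh := by funext v; simp [hyp, h]
    have h2 : hyp (k + 1) v = Real.sinh v := by simp [hyp, h, Nat.even_add_one]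
    rw [h1, h2]; exact Real.hasDerivAt_cosh v
  · rw [← Nat.not_even_iff_odd] at h
    have h1 : hyp k = Real.sinh := by funext v; simp [hyp, h]
    have h2 : hyp (k + 1) v = Real.cosh v := by simp [hyp, h, Nat.even_add_one]
    rw [h1, h2]; exact Real.hasDerivAt_sinh v

lemma hyp_neg (k : ℕ) (v : ℝ) : hyp k (-v) = (-1) ^ k * hyp k v := by
  rcases Nat.even_or_odd k with h | h
  · simp [hyp, h]
  · rw [h.neg_one_pow]
    rw [← Nat.not_even_iff_odd] at h
    simp [hyp, h]

/-- The hyperbolic sum `∑_{k < n} aₖ vᵏ hypᵏ(v)`. -/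
noncomputable def hypSum (a : ℕ → ℝ) (n : ℕ) (v : ℝ) : ℝ :=
  ∑ k ∈ Finset.range n, a k * v ^ k * hyp k v

/-- The termwise derivative of `hypSum a n`. -/
noncomputable def hypSumDeriv (a : ℕ → ℝ) (n : ℕ) (v : ℝ) : ℝ :=
  ∑ k ∈ Finset.range n, a k * (k * v ^ (k - 1) * hyp k v + v ^ k * hyp (k + 1) v)

/-- The second derivative of `hypSum a n` minus `hypSum a n` itself. -/
noncomputable def hypSumDefect (a : ℕ → ℝ) (n : ℕ) (v : ℝ) : ℝ :=
  ∑ k ∈ Finset.range n, a k *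
    (k * ((k - 1 : ℕ) * v ^ (k - 1 - 1)) * hyp k v + 2 * (k * v ^ (k - 1) * hyp (k + 1) v))

lemma hasDerivAt_hypSum (a : ℕ → ℝ) (n : ℕ) (v : ℝ) :
    HasDerivAt (hypSum a n) (hypSumDeriv a n v) v := by
  unfold hypSum hypSumDeriv
  refine HasDerivAt.fun_sum fun k _ => ?_
  have h := ((hasDerivAt_pow k v).mul (hasDerivAt_hyp k v)).const_mul (a k)
  refine h.congr_of_eventuallyEq (.of_forall fun x => ?_)
  simp [mul_assoc]

lemma hasDerivAt_hypSumDeriv (a : ℕ → ℝ) (n : ℕ) (v : ℝ) :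
    HasDerivAt (hypSumDeriv a n) (hypSum a n v + hypSumDefect a n v) v := by
  unfold hypSum hypSumDeriv hypSumDefect
  rw [← Finset.sum_add_distrib]
  refine HasDerivAt.fun_sum fun k _ => ?_
  have h := (((((hasDerivAt_pow (k - 1) v).const_mul (k : ℝ)).mul (hasDerivAt_hyp k v)).add
    ((hasDerivAt_pow k v).mul (hasDerivAt_hyp (k + 1) v))).const_mul (a k))
  refine (h.congr_deriv ?_)
  rw [show hyp (k + 1 + 1) v = hyp k v from congrFun (hyp_add_two k) v]
  ring

lemma hypSum_neg (a : ℕ → ℝ) (n : ℕ) (v : ℝ) : hypSum a n (-v) = hypSum a n v := by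
  refine Finset.sum_congr rfl fun k _ => ?_
  rw [hyp_neg, neg_pow]
  have : ((-1 : ℝ) ^ k) * (-1) ^ k = 1 := by rw [← mul_pow]; simp
  linear_combination (a k * v ^ k * hyp k v) * this

lemma hypSumDeriv_neg (a : ℕ → ℝ) (n : ℕ) (v : ℝ) :
    hypSumDeriv a n (-v) = -hypSumDeriv a n v := by
  have h1 := (hasDerivAt_hypSum a n (-v)).comp v (hasDerivAt_neg v)
  have h2 : hypSum a n ∘ Neg.neg = hypSum a n := funext fun v => hypSum_neg a n v
  rw [h2] at h1
  linarith [h1.unique (hasDerivAt_hypSum a n v)]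

lemma profile_eq_hypSum (s : ℕ) (α u : ℝ) :
    profile s α u = hypSum (coeff α s) (s + 1) (α * (u - 1 / 2)) := rfl

lemma normConst_eq_profile (s : ℕ) (α : ℝ) : normConst s α = profile s α 0 := by
  have : -α / 2 = α * (0 - 1 / 2) := by ring
  rw [normConst, profile, this]

/-- Comparison of coefficients in `α² F_{s+1} - F_{s+1}'' = 4 π² F_s`. -/
lemma nextHigherCoeff_recurrence (α : ℝ) (s : ℕ) (a : ℕ → ℝ) {j : ℕ} (hj : j ≤ s) :
    ((j : ℝ) + 2) * (j + 1) * nextHigherCoeff α s a (j + 1) +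
      2 * (j + 1) * nextHigherCoeff α s a j = -(4 * Real.pi ^ 2 / α ^ 2) * a j := by
  have hsum : ∑ i ∈ Finset.Icc j s, (-1 / 2 : ℝ) ^ (i - j) * (i.factorial : ℝ) * a i =
      j.factorial * a j - 1 / 2 *
        ∑ i ∈ Finset.Icc (j + 1) s, (-1 / 2 : ℝ) ^ (i - (j + 1)) * (i.factorial : ℝ) * a i := by
    rw [← Finset.add_sum_Ioc_eq_sum_Icc hj, Finset.mul_sum, sub_eq_add_neg,
      ← Finset.sum_neg_distrib]
    congr 1
    · simp
    · refine Finset.sum_congr ?_ fun i hi => ?_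
      · ext i
        rw [Finset.mem_Ioc, Finset.mem_Icc, Nat.lt_iff_add_one_le]
      · have hi' : i - j = (i - (j + 1)) + 1 := by
          have := (Finset.mem_Icc.mp hi).1
          omega
        rw [hi', pow_succ]; ring
  unfold nextHigherCoeff
  rw [hsum]
  have hf : (j.factorial : ℝ) ≠ 0 := by positivity
  have h1 : ((j + 1 + 1).factorial : ℝ) = (j + 2) * ((j + 1) * j.factorial) := by
    push_cast [Nat.factorial_succ]; ring
  have h2 : ((j + 1).factorial : ℝ) = (j + 1) * j.factorial := by
    push_cast [Nat.factorial_succ]; ring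
  rw [h1, h2]
  have : (j : ℝ) + 1 ≠ 0 := by positivity
  have : (j : ℝ) + 2 ≠ 0 := by positivity
  generalize
    (∑ i ∈ Finset.Icc (j + 1) s, (-1 / 2 : ℝ) ^ (i - (j + 1)) * (i.factorial : ℝ) * a i) = S
  rcases eq_or_ne α 0 with rfl | hα
  · simp
  · field_simp
    ring

lemma hypSumDefect_nextCoeff (α : ℝ) (s : ℕ) (a : ℕ → ℝ) (v : ℝ) :
    hypSumDefect (nextCoeff α s a) (s + 2) v = -(4 * Real.pi ^ 2 / α ^ 2) * hypSum a (s + 1) v := by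
  -- The sum defining this coefficient is empty, so the top term of the shifted sum disappears.
  have htop : nextHigherCoeff α s a (s + 1) = 0 := by simp [nextHigherCoeff]
  have h1 : ∑ k ∈ Finset.range (s + 2), nextCoeff α s a k * (k * ((k - 1 : ℕ) * v ^ (k - 1 - 1)) *
      hyp k v) = ∑ j ∈ Finset.range (s + 1),
        ((j : ℝ) + 2) * (j + 1) * nextHigherCoeff α s a (j + 1) * (v ^ j * hyp j v) := by
    rw [Finset.sum_range_succ', Finset.sum_range_succ', Finset.sum_range_succ, htop]
    simp only [CharP.cast_eq_zero, zero_mul, mul_zero, add_zero, zero_add, Nat.sub_self]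
    refine Finset.sum_congr rfl fun k _ => ?_
    rw [show hyp (k + 1 + 1) v = hyp k v from congrFun (hyp_add_two k) v]
    simp only [nextCoeff, Nat.add_sub_cancel]
    push_cast
    ring
  have h2 : ∑ k ∈ Finset.range (s + 2), nextCoeff α s a k * (2 * (k * v ^ (k - 1) *
      hyp (k + 1) v)) = ∑ j ∈ Finset.range (s + 1),
        2 * ((j : ℝ) + 1) * nextHigherCoeff α s a j * (v ^ j * hyp j v) := by
    rw [Finset.sum_range_succ']
    simp only [CharP.cast_eq_zero, zero_mul, mul_zero, add_zero]
    refine Finset.sum_congr rfl fun k _ => ?_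
    rw [show hyp (k + 1 + 1) v = hyp k v from congrFun (hyp_add_two k) v]
    simp only [nextCoeff, Nat.add_sub_cancel]
    push_cast
    ring
  simp only [hypSumDefect, mul_add, Finset.sum_add_distrib, h1, h2]
  rw [← Finset.sum_add_distrib, hypSum, Finset.mul_sum]
  refine Finset.sum_congr rfl fun j hj => ?_
  have := nextHigherCoeff_recurrence α s a (Finset.mem_range_succ_iff.mp hj)
  linear_combination (v ^ j * hyp j v) * this

/-- The coefficient of index `0` is chosen so that the derivative vanishes at `α / 2`. -/
lemma hypSumDeriv_nextCoeff {α : ℝ} (hα : 0 < α) (s : ℕ) (a : ℕ → ℝ) :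
    hypSumDeriv (nextCoeff α s a) (s + 2) (α / 2) = 0 := by
  have hs : Real.sinh (α / 2) ≠ 0 := (Real.sinh_pos_iff.mpr (by positivity)).ne'
  have h1 : hyp 1 (α / 2) = Real.sinh (α / 2) := by simp [hyp]
  rw [hypSumDeriv, Finset.sum_range_succ']
  simp only [CharP.cast_eq_zero, zero_mul, zero_add, pow_zero, one_mul, h1]
  rw [nextCoeff, div_mul_cancel₀ _ hs, add_neg_eq_zero]
  refine Finset.sum_congr rfl fun j _ => ?_
  simp [nextCoeff]

/-! ### Fourier series of the profiles and the closed form -/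

/-- Two integrations by parts in one step: for `e(u) = exp (-2 π i n u)`, the function
`f' e - f e'` has derivative `(f'' + 4 π² n² f) e`, and only the jump of `f'` survives at the end
points. -/
lemma integral_fourier_mul_of_hasDerivAt {f f' f'' : ℝ → ℝ} (hf : ∀ u, HasDerivAt f (f' u) u)
    (hf' : ∀ u, HasDerivAt f' (f'' u) u) (hf'' : Continuous f'') (h01 : f 0 = f 1) (n : ℤ) :
    ∫ u in (0 : ℝ)..1, fourier (-n) (u : UnitAddCircle) *
      ((f'' u + 4 * Real.pi ^ 2 * (n : ℝ) ^ 2 * f u : ℝ) : ℂ) = ((f' 1 - f' 0 : ℝ) : ℂ) := by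
  have he (u : ℝ) := hasDerivAt_fourier_neg 1 n u
  set c : ℂ := -2 * Real.pi * Complex.I * n / (1 : ℝ) with hc
  have hfc : Continuous f := continuous_iff_continuousAt.mpr fun u => (hf u).continuousAt
  have hD (u : ℝ) : HasDerivAt (fun u : ℝ => fourier (-n) (u : UnitAddCircle) * (f' u : ℂ) -
      c * fourier (-n) (u : UnitAddCircle) * (f u : ℂ)) (fourier (-n) (u : UnitAddCircle) *
      ((f'' u + 4 * Real.pi ^ 2 * (n : ℝ) ^ 2 * f u : ℝ) : ℂ)) u := by
    have h1 := (he u).mul ((hf' u).ofReal_comp)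
    have h2 := ((he u).const_mul c).mul ((hf u).ofReal_comp)
    refine (h1.sub h2).congr_deriv ?_
    have hcc : c * c = -(4 * Real.pi ^ 2 * (n : ℂ) ^ 2) := by
      rw [hc]; push_cast; ring_nf; rw [Complex.I_sq]; ring
    push_cast
    linear_combination (-(fourier (-n) (u : UnitAddCircle)) * (f u : ℂ)) * hcc
  rw [intervalIntegral.integral_eq_sub_of_hasDerivAt (fun u _ => hD u)]
  · have e1 : fourier (-n) (((1 : ℝ)) : UnitAddCircle) = 1 := by
      rw [show (((1 : ℝ)) : UnitAddCircle) = 0 from AddCircle.coe_period 1, fourier_eval_zero]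
    have e0 : fourier (-n) (((0 : ℝ)) : UnitAddCircle) = 1 := by
      rw [show (((0 : ℝ)) : UnitAddCircle) = 0 from rfl, fourier_eval_zero]
    simp only [e1, e0, h01]
    push_cast
    ring
  · refine Continuous.intervalIntegrable ?_ _ _
    have : Continuous fun u : ℝ => fourier (-n) (u : UnitAddCircle) :=
      (fourier (-n)).continuous.comp (AddCircle.continuous_mk' 1)
    fun_prop

/-- The derivative of `profile s α`. -/
noncomputable def profileDeriv (s : ℕ) (α u : ℝ) : ℝ :=
  α * hypSumDeriv (coeff α s) (s + 1) (α * (u - 1 / 2))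

lemma hasDerivAt_profile (s : ℕ) (α u : ℝ) :
    HasDerivAt (profile s α) (profileDeriv s α u) u := by
  have h := (hasDerivAt_hypSum (coeff α s) (s + 1) (α * (u - 1 / 2))).comp u
    (((hasDerivAt_id u).sub_const (1 / 2)).const_mul α)
  refine h.congr_deriv ?_
  simp [profileDeriv, mul_comm]

lemma continuous_profile (s : ℕ) (α : ℝ) : Continuous (profile s α) :=
  continuous_iff_continuousAt.mpr fun u => (hasDerivAt_profile s α u).continuousAt

lemma profile_one_sub (s : ℕ) (α u : ℝ) : profile s α (1 - u) = profile s α u := by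
  rw [profile_eq_hypSum, profile_eq_hypSum, ← hypSum_neg]
  ring_nf

lemma hasDerivAt_profileDeriv_zero (α u : ℝ) :
    HasDerivAt (profileDeriv 0 α) (α ^ 2 * profile 0 α u) u := by
  have h := ((hasDerivAt_hypSumDeriv (coeff α 0) 1 (α * (u - 1 / 2))).comp u
    (((hasDerivAt_id u).sub_const (1 / 2)).const_mul α)).const_mul α
  refine h.congr_deriv ?_
  simp only [hypSumDefect, profile_eq_hypSum]
  simp
  ring

lemma hasDerivAt_profileDeriv_succ {α : ℝ} (hα : 0 < α) (s : ℕ) (u : ℝ) :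
    HasDerivAt (profileDeriv (s + 1) α)
      (α ^ 2 * profile (s + 1) α u - 4 * Real.pi ^ 2 * profile s α u) u := by
  have h := ((hasDerivAt_hypSumDeriv (coeff α (s + 1)) (s + 2) (α * (u - 1 / 2))).comp u
    (((hasDerivAt_id u).sub_const (1 / 2)).const_mul α)).const_mul α
  refine h.congr_deriv ?_
  rw [show coeff α (s + 1) = nextCoeff α s (coeff α s) from rfl, hypSumDefect_nextCoeff,
    profile_eq_hypSum, profile_eq_hypSum, show coeff α (s + 1) = nextCoeff α s (coeff α s) from rfl]
  field_simp
  ring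

lemma profileDeriv_one_sub (s : ℕ) (α u : ℝ) :
    profileDeriv s α (1 - u) = -profileDeriv s α u := by
  rw [profileDeriv, profileDeriv, ← mul_neg, ← hypSumDeriv_neg]
  ring_nf

lemma profileDeriv_zero_one (α : ℝ) : profileDeriv 0 α 1 = α * Real.sinh (α / 2) := by
  rw [profileDeriv, show α * (1 - 1 / 2) = α / 2 by ring]
  simp [hypSumDeriv, coeff, hyp]

lemma profileDeriv_succ_one {α : ℝ} (hα : 0 < α) (s : ℕ) : profileDeriv (s + 1) α 1 = 0 := by
  rw [profileDeriv, show α * (1 - 1 / 2) = α / 2 by ring]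
  rw [show coeff α (s + 1) = nextCoeff α s (coeff α s) from rfl, hypSumDeriv_nextCoeff hα, mul_zero]

/-- The `n`-th Fourier coefficient of the profile. -/
lemma integral_fourier_mul_profile {α : ℝ} (hα : 0 < α) (s : ℕ) (n : ℤ) :
    ∫ u in (0 : ℝ)..1, fourier (-n) (u : UnitAddCircle) * ((profile s α u : ℝ) : ℂ) =
      (((4 * Real.pi ^ 2) ^ s * (2 * α * Real.sinh (α / 2)) *
        ((α ^ 2 + 4 * Real.pi ^ 2 * (n : ℝ) ^ 2) ^ (s + 1))⁻¹ : ℝ) : ℂ) := by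
  have hD : (0 : ℝ) < α ^ 2 + 4 * Real.pi ^ 2 * (n : ℝ) ^ 2 := by positivity
  have h01 (s : ℕ) : profile s α 0 = profile s α 1 := by
    rw [← profile_one_sub s α 1, sub_self]
  have hcont : Continuous fun u : ℝ => fourier (-n) (u : UnitAddCircle) :=
    (fourier (-n)).continuous.comp (AddCircle.continuous_mk' 1)
  have hDC : ((α ^ 2 + 4 * Real.pi ^ 2 * (n : ℝ) ^ 2 : ℝ) : ℂ) ≠ 0 := by exact_mod_cast hD.ne'
  induction s with
  | zero =>
    have h := integral_fourier_mul_of_hasDerivAt (hasDerivAt_profile 0 α)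
      (hasDerivAt_profileDeriv_zero α) ((continuous_profile 0 α).const_mul _) (h01 0) n
    have h0 : profileDeriv 0 α 0 = -(α * Real.sinh (α / 2)) := by
      rw [← profileDeriv_zero_one, ← profileDeriv_one_sub, sub_self]
    rw [h0, profileDeriv_zero_one] at h
    have h2 : ∀ u : ℝ, fourier (-n) (u : UnitAddCircle) *
        ((α ^ 2 * profile 0 α u + 4 * Real.pi ^ 2 * (n : ℝ) ^ 2 * profile 0 α u : ℝ) : ℂ) =
        ((α ^ 2 + 4 * Real.pi ^ 2 * (n : ℝ) ^ 2 : ℝ) : ℂ) *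
          (fourier (-n) (u : UnitAddCircle) * (profile 0 α u : ℂ)) := by
      intro u; push_cast; ring
    simp only [h2] at h
    rw [intervalIntegral.integral_const_mul] at h
    rw [← mul_right_inj' hDC, h]
    norm_cast
    field_simp
    ring
  | succ s ih =>
    have h := integral_fourier_mul_of_hasDerivAt (hasDerivAt_profile (s + 1) α)
      (hasDerivAt_profileDeriv_succ hα s) (((continuous_profile (s + 1) α).const_mul _).sub
        ((continuous_profile s α).const_mul _)) (h01 (s + 1)) n
    have h0 : profileDeriv (s + 1) α 0 = 0 := by
      rw [show (0 : ℝ) = 1 - 1 by ring, profileDeriv_one_sub, profileDeriv_succ_one hα]; ring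
    rw [h0, profileDeriv_succ_one hα] at h
    have h2 : ∀ u : ℝ, fourier (-n) (u : UnitAddCircle) *
        ((α ^ 2 * profile (s + 1) α u - 4 * Real.pi ^ 2 * profile s α u +
          4 * Real.pi ^ 2 * (n : ℝ) ^ 2 * profile (s + 1) α u : ℝ) : ℂ) =
        ((α ^ 2 + 4 * Real.pi ^ 2 * (n : ℝ) ^ 2 : ℝ) : ℂ) *
          (fourier (-n) (u : UnitAddCircle) * (profile (s + 1) α u : ℂ)) -
        ((4 * Real.pi ^ 2 : ℝ) : ℂ) * (fourier (-n) (u : UnitAddCircle) * (profile s α u : ℂ)) := by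
      intro u; push_cast; ring
    simp only [h2] at h
    have hi (s : ℕ) : Continuous fun u : ℝ => fourier (-n) (u : UnitAddCircle) *
        (profile s α u : ℂ) := hcont.mul (Complex.continuous_ofReal.comp (continuous_profile s α))
    rw [intervalIntegral.integral_sub (((hi _).const_mul _).intervalIntegrable _ _)
      (((hi _).const_mul _).intervalIntegrable _ _), intervalIntegral.integral_const_mul,
      intervalIntegral.integral_const_mul, ih, sub_self, Complex.ofReal_zero, sub_eq_zero] at h
    rw [← mul_right_inj' hDC, h]
    norm_cast
    field_simp
    ring

/-- The profile as a continuous function on the circle. -/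
noncomputable def circleProfile (s : ℕ) (α : ℝ) : C(UnitAddCircle, ℂ) where
  toFun x := (profile s α ‖x‖ : ℂ)
  continuous_toFun := Complex.continuous_ofReal.comp ((continuous_profile s α).comp continuous_norm)

/-- The distance to `0` on the circle is `u` or `1 - u`, and the profile is symmetric under
`u ↦ 1 - u`. -/
lemma profile_norm_coe (s : ℕ) (α : ℝ) {u : ℝ} (hu : u ∈ Set.Icc (0 : ℝ) 1) :
    profile s α ‖(u : UnitAddCircle)‖ = profile s α u := by
  rcases le_total u (1 / 2) with h | h
  · have h1 : ‖(u : UnitAddCircle)‖ = |u| :=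
      (AddCircle.norm_coe_eq_abs_iff (1 : ℝ) one_ne_zero).mpr
        (by rw [abs_of_nonneg hu.1, abs_one]; exact h)
    rw [h1, abs_of_nonneg hu.1]
  · have h0 : (u : UnitAddCircle) = ((u - 1 : ℝ) : UnitAddCircle) := by
      rw [AddCircle.coe_sub, AddCircle.coe_period, sub_zero]
    have h1 : ‖((u - 1 : ℝ) : UnitAddCircle)‖ = |u - 1| :=
      (AddCircle.norm_coe_eq_abs_iff (1 : ℝ) one_ne_zero).mpr
        (by rw [abs_of_nonpos (by linarith [hu.2]), abs_one]; linarith)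
    rw [h0, h1, abs_of_nonpos (by linarith [hu.2]), neg_sub, profile_one_sub]

lemma spectralWeight_half (s : ℕ) (α : ℝ) (n : ℤ) : spectralWeight (1 / 2 + (s : ℝ)) α n =
    ((α ^ 2 + 4 * Real.pi ^ 2 * (n : ℝ) ^ 2) ^ (s + 1))⁻¹ := by
  rw [spectralWeight, show -(1 / 2 + (s : ℝ)) - 1 / 2 = -((s + 1 : ℕ) : ℝ) by push_cast; ring,
    Real.rpow_neg (by positivity), Real.rpow_natCast]

lemma spectralWeight_pos {α : ℝ} (hα : 0 < α) (ν : ℝ) (n : ℤ) : 0 < spectralWeight ν α n :=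
  Real.rpow_pos_of_pos (by positivity) _

lemma summable_inv_add_sq {α : ℝ} (hα : 0 < α) :
    Summable fun n : ℤ => (α ^ 2 + 4 * Real.pi ^ 2 * (n : ℝ) ^ 2)⁻¹ := by
  have h : Summable fun n : ℤ => 1 / (n : ℝ) ^ 2 :=
    Real.summable_one_div_int_pow.mpr one_lt_two
  refine h.of_norm_bounded_eventually ?_
  rw [eventually_cofinite]
  refine (Set.finite_singleton (0 : ℤ)).subset fun n hn => ?_
  by_contra hn0
  refine hn ?_
  have hn1 : (n : ℝ) ≠ 0 := by exact_mod_cast hn0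
  rw [Real.norm_of_nonneg (by positivity), one_div]
  refine inv_anti₀ (by positivity) ?_
  nlinarith [sq_nonneg α, sq_nonneg (n : ℝ), Real.pi_gt_three,
    mul_nonneg (sq_nonneg (n : ℝ)) (by nlinarith [Real.pi_gt_three] : (0 : ℝ) ≤ Real.pi ^ 2 - 9)]

lemma summable_spectralWeight {α : ℝ} (hα : 0 < α) (s : ℕ) :
    Summable (spectralWeight (1 / 2 + (s : ℝ)) α) := by
  refine ((summable_inv_add_sq hα).mul_left ((α ^ 2) ^ s)⁻¹).of_nonneg_of_le
    (fun n => (spectralWeight_pos hα _ n).le) fun n => ?_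
  rw [spectralWeight_half, pow_succ, mul_inv]
  gcongr
  have : (0 : ℝ) ≤ 4 * Real.pi ^ 2 * (n : ℝ) ^ 2 := by positivity
  linarith

lemma fourierCoeff_circleProfile {α : ℝ} (hα : 0 < α) (s : ℕ) (n : ℤ) :
    fourierCoeff (circleProfile s α) n = (((4 * Real.pi ^ 2) ^ s * (2 * α * Real.sinh (α / 2)) *
      spectralWeight (1 / 2 + (s : ℝ)) α n : ℝ) : ℂ) := by
  rw [fourierCoeff_eq_intervalIntegral _ n 0, spectralWeight_half,
    ← integral_fourier_mul_profile hα]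
  simp only [div_one, one_smul, zero_add]
  refine intervalIntegral.integral_congr fun u hu => ?_
  rw [Set.uIcc_of_le zero_le_one] at hu
  simp only [smul_eq_mul, circleProfile, ContinuousMap.coe_mk, profile_norm_coe s α hu]

/-- The Fourier series of the profile, in real form. -/
lemma hasSum_profile {α : ℝ} (hα : 0 < α) (s : ℕ) (x : UnitAddCircle) :
    HasSum (fun n : ℤ => (4 * Real.pi ^ 2) ^ s * (2 * α * Real.sinh (α / 2)) *
      (spectralWeight (1 / 2 + (s : ℝ)) α n * (fourier n x).re)) (profile s α ‖x‖) := by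
  have hs : Summable (fourierCoeff (circleProfile s α)) := by
    have : fourierCoeff (circleProfile s α) = fun n => (((4 * Real.pi ^ 2) ^ s *
        (2 * α * Real.sinh (α / 2)) * spectralWeight (1 / 2 + (s : ℝ)) α n : ℝ) : ℂ) :=
      funext fun n => fourierCoeff_circleProfile hα s n
    rw [this]
    exact_mod_cast (summable_spectralWeight hα s).mul_left _
  have h := Complex.hasSum_re (has_pointwise_sum_fourier_series_of_summable hs x)
  have e : (circleProfile s α x).re = profile s α ‖x‖ := by simp [circleProfile]
  rw [e] at h
  refine h.congr_fun fun n => ?_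
  rw [fourierCoeff_circleProfile hα, smul_eq_mul, Complex.re_ofReal_mul]
  ring

/-- The total spectral mass `∑ₙ (α² + 4 π² n²) ^ (-s - 1)`. -/
noncomputable def totalWeight (s : ℕ) (α : ℝ) : ℝ := ∑' n : ℤ, spectralWeight (1 / 2 + (s : ℝ)) α n

lemma totalWeight_pos {α : ℝ} (hα : 0 < α) (s : ℕ) : 0 < totalWeight s α :=
  (summable_spectralWeight hα s).tsum_pos (fun n => (spectralWeight_pos hα _ n).le) 0
    (spectralWeight_pos hα _ 0)

lemma normConst_eq {α : ℝ} (hα : 0 < α) (s : ℕ) : normConst s α =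
    (4 * Real.pi ^ 2) ^ s * (2 * α * Real.sinh (α / 2)) * totalWeight s α := by
  have h := (hasSum_profile hα s 0).tsum_eq
  rw [norm_zero, ← normConst_eq_profile] at h
  rw [← h, totalWeight, ← tsum_mul_left]
  simp

lemma covariogram_eq_profile {α : ℝ} (hα : 0 < α) (s : ℕ) (σ : ℝ) (x y : UnitAddCircle) :
    covariogram (1 / 2 + (s : ℝ)) σ α x y =
      σ ^ 2 / normConst s α * profile s α ‖x - y‖ := by
  have hs : 0 < Real.sinh (α / 2) := Real.sinh_pos_iff.mpr (by positivity)
  have hW := totalWeight_pos hα s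
  rw [← (hasSum_profile hα s (x - y)).tsum_eq, tsum_mul_left, normConst_eq hα, covariogram,
    ← totalWeight]
  field_simp

/-! ### Absolute continuity of infinite products -/

open scoped ENNReal NNReal Topology

lemma pi_withDensity {ι : Type*} [Fintype ι] {X : ι → Type*} [∀ i, MeasurableSpace (X i)]
    (μ : ∀ i, Measure (X i)) [∀ i, IsProbabilityMeasure (μ i)] (f : ∀ i, X i → ℝ≥0∞)
    (hf : ∀ i, Measurable (f i)) [∀ i, SigmaFinite ((μ i).withDensity (f i))] :
    Measure.pi (fun i => (μ i).withDensity (f i)) =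
      (Measure.pi μ).withDensity fun x => ∏ i, f i (x i) := by
  refine (Measure.pi_eq fun s hs => ?_)
  have hind : iIndepFun (fun i (x : ∀ i, X i) => (s i).indicator (f i) (x i)) (Measure.pi μ) :=
    iIndepFun_pi fun i => ((hf i).indicator (hs i)).aemeasurable
  have h := lintegral_prod_eq_prod_lintegral_of_indepFun Finset.univ _ hind
    fun i => ((hf i).indicator (hs i)).comp (measurable_pi_apply i)
  rw [withDensity_apply _ (MeasurableSet.univ_pi hs), ← lintegral_indicator
    (MeasurableSet.univ_pi hs)]
  have h1 (x : ∀ i, X i) : (Set.univ.pi s).indicator (fun x => ∏ i, f i (x i)) x =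
      ∏ i, (s i).indicator (f i) (x i) := by
    by_cases hx : x ∈ Set.univ.pi s
    · rw [Set.indicator_of_mem hx]
      exact Finset.prod_congr rfl fun i _ => (Set.indicator_of_mem (hx i trivial) _).symm
    · rw [Set.indicator_of_notMem hx]
      obtain ⟨i, hi⟩ : ∃ i, x i ∉ s i := by simpa using hx
      exact (Finset.prod_eq_zero (Finset.mem_univ i) (Set.indicator_of_notMem hi _)).symm
  simp only [h1]
  rw [h]
  refine Finset.prod_congr rfl fun i _ => ?_
  rw [withDensity_apply _ (hs i), ← lintegral_indicator (hs i)]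
  exact (measurePreserving_eval μ i).lintegral_comp ((hf i).indicator (hs i))

/-- On a finite product, an event that is unlikely for `⨂ μᵢ` is unlikely for `⨂ exp(gᵢ) μᵢ`, up to
the probability that the logarithmic density exceeds a level `K`; this probability is controlled by
Markov's inequality. -/
lemma pi_withDensity_exp_le {ι : Type*} [Fintype ι] {X : ι → Type*} [∀ i, MeasurableSpace (X i)]
    (μ ν : ∀ i, Measure (X i)) [∀ i, IsProbabilityMeasure (μ i)] [∀ i, IsProbabilityMeasure (ν i)]
    (g : ∀ i, X i → ℝ) (hg : ∀ i, Measurable (g i))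
    (hν : ∀ i, ν i = (μ i).withDensity fun x => ENNReal.ofReal (Real.exp (g i x)))
    {K : ℝ≥0} (hK : 0 < K) {B : Set (∀ i, X i)} (hB : MeasurableSet B) :
    Measure.pi ν B ≤ ENNReal.ofReal (Real.exp K) * Measure.pi μ B +
      (∑ i, ∫⁻ x, ‖g i x‖ₑ ∂(ν i)) / K := by
  have hpi : Measure.pi ν = (Measure.pi μ).withDensity
      fun x => ∏ i, ENNReal.ofReal (Real.exp (g i (x i))) := by
    have : ∀ i, SigmaFinite ((μ i).withDensity fun x => ENNReal.ofReal (Real.exp (g i x))) :=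
      fun i => by rw [← hν i]; infer_instance
    rw [← pi_withDensity μ (fun i x => ENNReal.ofReal (Real.exp (g i x)))
      fun i => (Real.measurable_exp.comp (hg i)).ennreal_ofReal]
    congr 1
    exact funext hν
  have hgi (i : ι) : Measurable fun x : ∀ i, X i => ‖g i (x i)‖ₑ :=
    ((hg i).comp (measurable_pi_apply i)).enorm
  set G : (∀ i, X i) → ℝ≥0∞ := fun x => ∑ i, ‖g i (x i)‖ₑ with hG
  have hGm : Measurable G := Finset.measurable_sum _ fun i _ => hgi i
  have hGint : ∫⁻ x, G x ∂(Measure.pi ν) = ∑ i, ∫⁻ x, ‖g i x‖ₑ ∂(ν i) := by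
    rw [lintegral_finsetSum _ fun i _ => hgi i]
    exact Finset.sum_congr rfl fun i _ => (measurePreserving_eval ν i).lintegral_comp (hg i).enorm
  have hS : MeasurableSet {x | (K : ℝ≥0∞) ≤ G x} := measurableSet_le measurable_const hGm
  calc Measure.pi ν B ≤ Measure.pi ν ((B ∩ {x | (K : ℝ≥0∞) ≤ G x}ᶜ) ∪ {x | (K : ℝ≥0∞) ≤ G x}) := by
        refine measure_mono fun x hx => ?_
        by_cases h : (K : ℝ≥0∞) ≤ G x
        · exact Or.inr h
        · exact Or.inl ⟨hx, h⟩
    _ ≤ Measure.pi ν (B ∩ {x | (K : ℝ≥0∞) ≤ G x}ᶜ) + Measure.pi ν {x | (K : ℝ≥0∞) ≤ G x} :=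
        measure_union_le _ _
    _ ≤ _ := by
        gcongr
        · rw [hpi, withDensity_apply _ (hB.inter hS.compl)]
          calc _ ≤ ∫⁻ _ in B ∩ {x | (K : ℝ≥0∞) ≤ G x}ᶜ,
                  ENNReal.ofReal (Real.exp K) ∂(Measure.pi μ) := by
                refine setLIntegral_mono measurable_const fun x hx => ?_
                rw [← ENNReal.ofReal_prod_of_nonneg fun _ _ => (Real.exp_pos _).le, ← Real.exp_sum]
                refine ENNReal.ofReal_le_ofReal (Real.exp_le_exp.mpr ?_)
                have h1 : G x < K := not_le.mp hx.2
                have h2 : G x = ENNReal.ofReal (∑ i, |g i (x i)|) := by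
                  rw [ENNReal.ofReal_sum_of_nonneg fun _ _ => abs_nonneg _]
                  exact Finset.sum_congr rfl fun i _ => Real.enorm_eq_ofReal_abs _
                rw [h2, ← ENNReal.ofReal_coe_nnreal] at h1
                have h3 := (ENNReal.ofReal_lt_ofReal_iff (by exact_mod_cast hK)).mp h1
                exact (Finset.sum_le_sum fun i _ => le_abs_self _).trans h3.le
            _ = ENNReal.ofReal (Real.exp K) * Measure.pi μ (B ∩ {x | (K : ℝ≥0∞) ≤ G x}ᶜ) := by
                rw [setLIntegral_const]
            _ ≤ _ := by gcongr; exact Set.inter_subset_left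
        · rw [← hGint]
          exact meas_ge_le_lintegral_div hGm.aemeasurable (by exact_mod_cast hK.ne')
            ENNReal.coe_ne_top

/-- If the logarithmic densities of the factors have summable `L¹` norms, the infinite product
measures are absolutely continuous. -/
theorem infinitePi_absolutelyContinuous {ι : Type*} {X : ι → Type*} [∀ i, MeasurableSpace (X i)]
    (μ ν : ∀ i, Measure (X i)) [∀ i, IsProbabilityMeasure (μ i)] [∀ i, IsProbabilityMeasure (ν i)]
    (g : ∀ i, X i → ℝ) (hg : ∀ i, Measurable (g i))
    (hν : ∀ i, ν i = (μ i).withDensity fun x => ENNReal.ofReal (Real.exp (g i x)))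
    (hsum : ∑' i, ∫⁻ x, ‖g i x‖ₑ ∂(ν i) ≠ ∞) :
    Measure.infinitePi ν ≪ Measure.infinitePi μ := by
  set C := ∑' i, ∫⁻ x, ‖g i x‖ₑ ∂(ν i) with hC
  have hcyl {K : ℝ≥0} (hK : 0 < K) {A : Set (∀ i, X i)} (hA : A ∈ measurableCylinders X) :
      Measure.infinitePi ν A ≤ ENNReal.ofReal (Real.exp K) * Measure.infinitePi μ A + C / K := by
    obtain ⟨I, B, hB, rfl⟩ := (mem_measurableCylinders A).mp hA
    rw [Measure.infinitePi_cylinder _ hB, Measure.infinitePi_cylinder _ hB]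
    refine (pi_withDensity_exp_le (fun i : I => μ i) (fun i : I => ν i) (fun i : I => g i)
      (fun i => hg i) (fun i => hν i) hK hB).trans ?_
    gcongr
    rw [Finset.univ_eq_attach, Finset.sum_attach I fun i => ∫⁻ x, ‖g i x‖ₑ ∂(ν i)]
    exact ENNReal.sum_le_tsum I
  refine Measure.AbsolutelyContinuous.mk fun s hs hμs => ?_
  have hdense := Measure.MeasureDense.of_generateFrom_isSetAlgebra_finite
    (Measure.infinitePi μ + Measure.infinitePi ν)
    (isSetAlgebra_measurableCylinders (α := X)) generateFrom_measurableCylinders.symm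
  -- Cylinders approximate `s` for both product measures at once.
  have hle {K : ℝ≥0} (hK : 0 < K) {ε : ℝ} (hε : 0 < ε) :
      Measure.infinitePi ν s ≤
        (ENNReal.ofReal (Real.exp K) + 1) * ENNReal.ofReal ε + C / K := by
    obtain ⟨t, ht, hst⟩ := hdense.approx s hs (measure_ne_top _ _) ε hε
    rw [Measure.add_apply] at hst
    have h1 : Measure.infinitePi μ t ≤ ENNReal.ofReal ε := by
      calc Measure.infinitePi μ t ≤ Measure.infinitePi μ (s ∪ symmDiff s t) := by
            refine measure_mono fun x hx => ?_
            by_cases h : x ∈ s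
            · exact Or.inl h
            · exact Or.inr (Or.inr ⟨hx, h⟩)
        _ ≤ _ := measure_union_le _ _
        _ ≤ ENNReal.ofReal ε := by
            rw [hμs, zero_add]; exact le_self_add.trans hst.le
    have h2 : Measure.infinitePi ν s ≤ Measure.infinitePi ν t + ENNReal.ofReal ε := by
      calc Measure.infinitePi ν s ≤ Measure.infinitePi ν (t ∪ symmDiff s t) := by
            refine measure_mono fun x hx => ?_
            by_cases h : x ∈ t
            · exact Or.inl h
            · exact Or.inr (Or.inl ⟨hx, h⟩)
        _ ≤ _ := measure_union_le _ _
        _ ≤ _ := by gcongr; exact le_add_self.trans hst.le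
    calc _ ≤ _ := h2
      _ ≤ (ENNReal.ofReal (Real.exp K) * ENNReal.ofReal ε + C / K) + ENNReal.ofReal ε := by
          gcongr
          exact (hcyl hK ht).trans (by gcongr)
      _ = _ := by ring
  have hle2 {K : ℝ≥0} (hK : 0 < K) : Measure.infinitePi ν s ≤ C / K := by
    have hlim : Tendsto (fun n : ℕ => (ENNReal.ofReal (Real.exp K) + 1) *
        ENNReal.ofReal (1 / ((n : ℝ) + 1)) + C / K) atTop
        (𝓝 ((ENNReal.ofReal (Real.exp K) + 1) * ENNReal.ofReal 0 + C / K)) :=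
      (ENNReal.Tendsto.const_mul (ENNReal.tendsto_ofReal tendsto_one_div_add_atTop_nhds_zero_nat)
        (Or.inr (by simp))).add_const _
    have := ge_of_tendsto' hlim fun n => hle hK (by positivity)
    simpa using this
  have hlim : Tendsto (fun n : ℕ => C / ((n : ℝ≥0∞))) atTop (𝓝 0) := by
    have := ENNReal.Tendsto.const_mul ENNReal.tendsto_inv_nat_nhds_zero (Or.inr hsum)
    simpa [div_eq_mul_inv, hC] using this
  refine le_antisymm (ge_of_tendsto hlim ?_) zero_le
  filter_upwards [eventually_gt_atTop 0] with n hn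
  exact_mod_cast hle2 (K := (n : ℝ≥0)) (by exact_mod_cast hn)

/-! ### Sequences of independent centred Gaussian variables -/

/-- The law of independent centred Gaussian variables with variances `v i`. -/
noncomputable def gaussianSeq {ι : Type*} (v : ι → ℝ≥0) : Measure (ι → ℝ) :=
  Measure.infinitePi fun i => gaussianReal 0 (v i)

instance {ι : Type*} (v : ι → ℝ≥0) : IsProbabilityMeasure (gaussianSeq v) := by
  unfold gaussianSeq; infer_instance

lemma gaussianReal_eq_withDensity_exp {v w : ℝ≥0} (hv : v ≠ 0) (hw : w ≠ 0) :
    gaussianReal 0 v = (gaussianReal 0 w).withDensity fun x => ENNReal.ofReal (Real.exp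
      (-(1 / 2) * Real.log (v / w) + x ^ 2 * (((v : ℝ) / w - 1) / (2 * v)))) := by
  have hv' : (0 : ℝ) < v := by positivity
  have hw' : (0 : ℝ) < w := by positivity
  rw [gaussianReal_of_var_ne_zero _ hv, gaussianReal_of_var_ne_zero _ hw,
    ← withDensity_mul _ (measurable_gaussianPDF 0 w) (by fun_prop)]
  congr 1
  funext x
  rw [Pi.mul_apply, gaussianPDF, gaussianPDF, ← ENNReal.ofReal_mul (gaussianPDFReal_nonneg _ _ _)]
  congr 1
  have hlog : Real.exp (-(1 / 2) * Real.log (v / w)) = √(2 * Real.pi * w) / √(2 * Real.pi * v) := by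
    rw [← Real.sqrt_div (by positivity), mul_div_mul_left _ _ (by positivity), Real.sqrt_eq_rpow,
      Real.rpow_def_of_pos (by positivity), ← inv_div (v : ℝ) (w : ℝ), Real.log_inv]
    ring_nf
  rw [gaussianPDFReal, gaussianPDFReal, Real.exp_add, hlog]
  have h1 : √(2 * Real.pi * w) ≠ 0 := by positivity
  have h2 : √(2 * Real.pi * v) ≠ 0 := by positivity
  have h3 : Real.exp (-(x - 0) ^ 2 / (2 * v)) = Real.exp (-(x - 0) ^ 2 / (2 * w)) *
      Real.exp (x ^ 2 * (((v : ℝ) / w - 1) / (2 * v))) := by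
    rw [← Real.exp_add]
    congr 1
    field_simp
    ring
  rw [h3]
  field_simp

lemma lintegral_sq_gaussianReal (v : ℝ≥0) :
    ∫⁻ x, ENNReal.ofReal (x ^ 2) ∂(gaussianReal 0 v) = v := by
  have h := variance_fun_id_gaussianReal (μ := 0) (v := v)
  have hm : MemLp (fun x : ℝ => x) 2 (gaussianReal 0 v) := memLp_id_gaussianReal 2
  rw [variance_eq_sub hm, integral_id_gaussianReal] at h
  rw [← ofReal_integral_eq_lintegral_ofReal hm.integrable_sq (.of_forall fun x => sq_nonneg x)]
  have h' : ∫ x, x ^ 2 ∂(gaussianReal 0 v) = v := by simpa using h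
  rw [h', ENNReal.ofReal_coe_nnreal]

/-- A summable relative deviation of the variances suffices: the logarithmic density of
`N(0, v)` with respect to `N(0, w)` has `L¹` norm at most `(|log (v / w)| + |v / w - 1|) / 2`. -/
theorem gaussianSeq_absolutelyContinuous {ι : Type*} {v w : ι → ℝ≥0} (hv : ∀ i, v i ≠ 0)
    (hw : ∀ i, w i ≠ 0) (h : Summable fun i => (v i : ℝ) / w i - 1) :
    gaussianSeq v ≪ gaussianSeq w := by
  refine infinitePi_absolutelyContinuous _ _ (fun i x =>
    -(1 / 2) * Real.log (v i / w i) + x ^ 2 * (((v i : ℝ) / w i - 1) / (2 * v i)))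
    (fun i => by fun_prop) (fun i => gaussianReal_eq_withDensity_exp (hv i) (hw i)) ?_
  have hlog : Summable fun i => Real.log ((v i : ℝ) / w i) := by
    simpa using Real.summable_log_one_add_of_summable h
  have hb : Summable fun i => 1 / 2 * |Real.log ((v i : ℝ) / w i)| + 1 / 2 * |(v i : ℝ) / w i - 1| :=
    (hlog.abs.mul_left _).add (h.abs.mul_left _)
  -- Under `N(0, v)` the square has mean `v`, which cancels the denominator `2 v`.
  refine ne_top_of_le_ne_top hb.tsum_ofReal_ne_top (ENNReal.tsum_le_tsum fun i => ?_)
  have hvi : (0 : ℝ) < v i := by have := hv i; positivity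
  calc _ ≤ ∫⁻ x, (ENNReal.ofReal (1 / 2 * |Real.log ((v i : ℝ) / w i)|) +
        ENNReal.ofReal (x ^ 2) * ENNReal.ofReal (|(v i : ℝ) / w i - 1| / (2 * v i)))
          ∂(gaussianReal 0 (v i)) := by
        refine lintegral_mono fun x => ?_
        rw [Real.enorm_eq_ofReal_abs, ← ENNReal.ofReal_mul (sq_nonneg x),
          ← ENNReal.ofReal_add (by positivity) (by positivity)]
        refine ENNReal.ofReal_le_ofReal ((abs_add_le _ _).trans (le_of_eq ?_))
        rw [abs_mul, abs_mul, abs_div, abs_of_nonneg (sq_nonneg x),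
          abs_of_pos (by positivity : (0 : ℝ) < 2 * v i)]
        norm_num
    _ = _ := by
        rw [lintegral_add_left measurable_const, lintegral_const, measure_univ, mul_one,
          lintegral_mul_const _ (by fun_prop), lintegral_sq_gaussianReal,
          ENNReal.ofReal_add (by positivity) (by positivity), ← ENNReal.ofReal_coe_nnreal,
          ← ENNReal.ofReal_mul (by positivity)]
        congr 2
        field_simp

/-- The law of large numbers for the normalised squares determines the scale of the variances. -/
lemma gaussianSeq_ae_tendsto {v : ℤ → ℝ≥0} (hv : ∀ i, v i ≠ 0) (c : ℝ≥0) :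
    ∀ᵐ x ∂(gaussianSeq fun i => c * v i),
      Tendsto (fun n : ℕ => (∑ k ∈ Finset.range n, x (k : ℤ) ^ 2 / (v k : ℝ)) / (n : ℝ)) atTop
        (𝓝 (c : ℝ)) := by
  have hlaw (k : ℤ) : (gaussianSeq fun i => c * v i).map (fun x => x k) = gaussianReal 0 (c * v k) :=
    Measure.infinitePi_map_eval _ k
  have hvr (k : ℤ) : (0 : ℝ) < v k := by have := hv k; positivity
  have hlaw' (k : ℤ) : (gaussianSeq fun i => c * v i).map (fun x => x k / √(v k)) =
      gaussianReal 0 c := by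
    have : (fun x : ℤ → ℝ => x k / √(v k)) = (fun y : ℝ => y / √(v k)) ∘ fun x => x k := rfl
    rw [this, ← Measure.map_map (by fun_prop) (by fun_prop), hlaw, gaussianReal_map_div_const]
    congr 1
    · simp
    · ext
      have := (hvr k).ne'
      simp only [NNReal.coe_div, NNReal.coe_mul, NNReal.coe_mk]
      rw [Real.sq_sqrt (hvr k).le]
      field_simp
  have hsq (k : ℤ) (x : ℤ → ℝ) : x k ^ 2 / v k = (x k / √(v k)) ^ 2 := by
    rw [div_pow, Real.sq_sqrt (hvr k).le]
  have hid (k : ℤ) : IdentDistrib (fun x : ℤ → ℝ => x k / √(v k)) id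
      (gaussianSeq fun i => c * v i) (gaussianReal 0 c) :=
    ⟨(by fun_prop : Measurable _).aemeasurable, aemeasurable_id, by rw [hlaw', Measure.map_id]⟩
  have hid2 (k : ℤ) : IdentDistrib (fun x : ℤ → ℝ => x k ^ 2 / v k) (fun y : ℝ => y ^ 2)
      (gaussianSeq fun i => c * v i) (gaussianReal 0 c) := by
    simp only [hsq]
    exact (hid k).comp (u := fun y : ℝ => y ^ 2) (by fun_prop)
  have hmem : MemLp (fun x : ℝ => x) 2 (gaussianReal 0 c) := memLp_id_gaussianReal 2
  have hmean : ∫ y, y ^ 2 ∂(gaussianReal 0 c) = c := by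
    have h := variance_fun_id_gaussianReal (μ := 0) (v := c)
    rw [variance_eq_sub hmem, integral_id_gaussianReal] at h
    simpa using h
  have hindep : iIndepFun (fun (k : ℤ) (x : ℤ → ℝ) => x k ^ 2 / v k)
      (gaussianSeq fun i => c * v i) :=
    iIndepFun_infinitePi (X := fun k (y : ℝ) => y ^ 2 / v k) fun k => by fun_prop
  have h := strong_law_ae_real (μ := gaussianSeq fun i => c * v i)
    (fun (k : ℕ) (x : ℤ → ℝ) => x k ^ 2 / v k)
    ((hid2 0).integrable_iff.mpr hmem.integrable_sq)
    (fun i j hij => hindep.indepFun (by exact_mod_cast hij))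
    (fun i => (hid2 i).trans (hid2 0).symm)
  have he : ∫ x, x ((0 : ℕ) : ℤ) ^ 2 / v ((0 : ℕ) : ℤ) ∂(gaussianSeq fun i => c * v i) = c := by
    rw [← hmean]; exact (hid2 0).integral_eq
  rwa [he] at h

theorem eq_of_gaussianSeq_absolutelyContinuous {v : ℤ → ℝ≥0} (hv : ∀ i, v i ≠ 0) {c d : ℝ≥0}
    (h : gaussianSeq (fun i => c * v i) ≪ gaussianSeq fun i => d * v i) : c = d := by
  have h1 := gaussianSeq_ae_tendsto hv c
  have h2 := h.ae_le (gaussianSeq_ae_tendsto hv d)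
  obtain ⟨x, hx1, hx2⟩ := (h1.and h2).exists
  exact_mod_cast tendsto_nhds_unique hx1 hx2

/-! ### The Hartley basis of the circle -/

/-- The Hartley function `cos (2 π n x) + sin (2 π n x)`.  These functions form a real orthonormal
basis indexed by `ℤ`, without separate cosine and sine families. -/
noncomputable def cas (n : ℤ) (x : UnitAddCircle) : ℝ := (fourier n x).re + (fourier n x).im

lemma continuous_cas (n : ℤ) : Continuous (cas n) :=
  (Complex.continuous_re.comp (fourier n).continuous).add
    (Complex.continuous_im.comp (fourier n).continuous)

lemma cas_zero_right (n : ℤ) : cas n 0 = 1 := by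
  simp [cas]

lemma abs_cas_le (n : ℤ) (x : UnitAddCircle) : |cas n x| ≤ 2 := by
  have h : ‖fourier n x‖ = 1 := by rw [fourier_apply, Circle.norm_coe]
  have h1 := Complex.abs_re_le_norm (fourier n x)
  have h2 := Complex.abs_im_le_norm (fourier n x)
  have h3 := abs_add_le (fourier n x).re (fourier n x).im
  rw [h] at h1 h2
  unfold cas
  linarith

lemma cas_mul_cas_same_index (n : ℤ) (x y : UnitAddCircle) :
    cas n x * cas n y = (fourier n (x - y)).re + (fourier n (x + y)).im := by
  have h1 : fourier n (x + y) = fourier n x * fourier n y := by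
    simp only [fourier_apply, zsmul_add, AddCircle.toCircle_add, Circle.coe_mul]
  have h2 : fourier n (x - y) = fourier n x * (starRingEnd ℂ) (fourier n y) := by
    rw [← fourier_neg]
    simp only [fourier_apply, sub_eq_add_neg, zsmul_add, AddCircle.toCircle_add, Circle.coe_mul,
      smul_neg, neg_smul]
  rw [h1, h2]
  simp only [cas, Complex.mul_re, Complex.mul_im, Complex.conj_re, Complex.conj_im]
  ring

lemma cas_mul_cas_same_point (n m : ℤ) (x : UnitAddCircle) :
    cas n x * cas m x = (fourier (n - m) x).re + (fourier (n + m) x).im := by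
  have h2 : fourier (n - m) x = fourier n x * (starRingEnd ℂ) (fourier m x) := by
    rw [← fourier_neg, sub_eq_add_neg, fourier_add]
  rw [h2, fourier_add]
  simp only [cas, Complex.mul_re, Complex.mul_im, Complex.conj_re, Complex.conj_im]
  ring

lemma integral_fourier_eq_ite (n : ℤ) :
    ∫ x : UnitAddCircle, fourier n x ∂AddCircle.haarAddCircle = if n = 0 then 1 else 0 := by
  split_ifs with h
  · simp [h]
  · exact integral_eq_zero_of_add_right_eq_neg (fourier_add_half_inv_index h one_pos)

lemma integral_cas_mul_cas (n m : ℤ) :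
    ∫ x : UnitAddCircle, cas n x * cas m x ∂AddCircle.haarAddCircle = if n = m then 1 else 0 := by
  have hi (k : ℤ) : Integrable (fun x : UnitAddCircle => fourier k x) AddCircle.haarAddCircle :=
    (fourier k).continuous.integrable_of_hasCompactSupport (.of_compactSpace _)
  simp only [cas_mul_cas_same_point]
  have hre : ∫ x : UnitAddCircle, (fourier (n - m) x).re ∂AddCircle.haarAddCircle =
      (∫ x : UnitAddCircle, fourier (n - m) x ∂AddCircle.haarAddCircle).re := integral_re (hi _)
  have him : ∫ x : UnitAddCircle, (fourier (n + m) x).im ∂AddCircle.haarAddCircle =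
      (∫ x : UnitAddCircle, fourier (n + m) x ∂AddCircle.haarAddCircle).im := integral_im (hi _)
  have hadd : ∫ x : UnitAddCircle, ((fourier (n - m) x).re + (fourier (n + m) x).im)
      ∂AddCircle.haarAddCircle = ∫ x : UnitAddCircle, (fourier (n - m) x).re
        ∂AddCircle.haarAddCircle + ∫ x : UnitAddCircle, (fourier (n + m) x).im
        ∂AddCircle.haarAddCircle := integral_add (hi _).re (hi _).im
  rw [hadd, hre, him, integral_fourier_eq_ite, integral_fourier_eq_ite]
  simp only [sub_eq_zero]
  split_ifs <;> simp

/-- Uniqueness of Hartley coefficients. -/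
lemma eq_zero_of_hasSum_cas {b : ℤ → ℝ} (h : ∀ x, HasSum (fun n => b n * cas n x) 0) (m : ℤ) :
    b m = 0 := by
  -- All Hartley functions equal `1` at the origin, so the coefficients are absolutely summable.
  have hb : Summable b := by simpa [cas_zero_right] using (h 0).summable
  have hcont (n : ℤ) : Continuous fun x => b n * cas n x * cas m x :=
    ((continuous_cas n).const_mul _).mul (continuous_cas m)
  have hle (n : ℤ) (x : UnitAddCircle) : ‖b n * cas n x * cas m x‖ ≤ |b n| * 4 := by
    rw [Real.norm_eq_abs, abs_mul, abs_mul, mul_assoc]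
    gcongr
    nlinarith [abs_cas_le n x, abs_cas_le m x, abs_nonneg (cas n x), abs_nonneg (cas m x)]
  have hint (n : ℤ) : Integrable (fun x => b n * cas n x * cas m x)
      (AddCircle.haarAddCircle (T := 1)) :=
    (hcont n).integrable_of_hasCompactSupport (.of_compactSpace _)
  have hs := hasSum_integral_of_summable_integral_norm hint
    ((hb.abs.mul_right 4).of_nonneg_of_le (fun n => integral_nonneg fun x => norm_nonneg _)
      fun n => by
        calc _ ≤ ∫ _ : UnitAddCircle, |b n| * 4 ∂AddCircle.haarAddCircle :=
              integral_mono (hint n).norm (integrable_const _) (hle n)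
          _ = _ := by simp)
  have h0 (x : UnitAddCircle) : ∑' n, b n * cas n x * cas m x = 0 := by
    rw [tsum_mul_right, (h x).tsum_eq, zero_mul]
  simp only [h0, integral_zero] at hs
  simp only [mul_assoc, integral_const_mul, integral_cas_mul_cas] at hs
  have := hs.unique (hasSum_single m fun n hn => by simp [hn])
  simpa using this.symm

/-- The random Fourier series has the covariance prescribed by its even spectrum: the sine part
cancels between `n` and `-n`. -/
lemma tsum_mul_cas_mul_cas {w : ℤ → ℝ} (hw : Summable w) (heven : ∀ n, w (-n) = w n)
    (x y : UnitAddCircle) :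
    ∑' n, w n * (cas n x * cas n y) = ∑' n, w n * (fourier n (x - y)).re := by
  have hb (n : ℤ) (z : UnitAddCircle) : ‖fourier n z‖ = 1 := by rw [fourier_apply, Circle.norm_coe]
  have hre : Summable fun n => w n * (fourier n (x - y)).re := by
    refine hw.abs.of_norm_bounded fun n => ?_
    rw [Real.norm_eq_abs, abs_mul]
    exact mul_le_of_le_one_right (abs_nonneg _) ((Complex.abs_re_le_norm _).trans (hb _ _).le)
  have him : Summable fun n => w n * (fourier n (x + y)).im := by
    refine hw.abs.of_norm_bounded fun n => ?_
    rw [Real.norm_eq_abs, abs_mul]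
    exact mul_le_of_le_one_right (abs_nonneg _) ((Complex.abs_im_le_norm _).trans (hb _ _).le)
  have hodd : ∑' n, w n * (fourier n (x + y)).im = 0 := by
    have h := (Equiv.neg ℤ).tsum_eq fun n => w n * (fourier n (x + y)).im
    simp only [Equiv.neg_apply, heven, fourier_neg, Complex.conj_im, mul_neg] at h
    rw [tsum_neg] at h
    linarith
  simp only [cas_mul_cas_same_index, mul_add]
  rw [hre.tsum_add him, hodd, add_zero]

/-! ### Orthogonal series in a Hilbert space -/

section Hilbert

variable {E : Type*} [NormedAddCommGroup E] [InnerProductSpace ℝ E] [CompleteSpace E]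

lemma summable_of_orthogonal {ι : Type*} {e : ι → E}
    (horth : Pairwise fun i j => inner ℝ (e i) (e j) = 0) (hsum : Summable fun i => ‖e i‖ ^ 2) :
    Summable e := by
  have hV : OrthogonalFamily ℝ (fun i => (Submodule.span ℝ {e i} : Submodule ℝ E))
      fun i => (Submodule.span ℝ {e i}).subtypeₗᵢ :=
    OrthogonalFamily.of_pairwise fun i j hij => by
      change Submodule.IsOrtho _ _
      rw [Submodule.isOrtho_span]
      rintro _ rfl _ rfl
      exact horth hij
  exact (hV.summable_iff_norm_sq_summable
    fun i => ⟨e i, Submodule.mem_span_singleton_self _⟩).mpr hsum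

variable {e : ℤ → E}

lemma summable_cas_smul (horth : Pairwise fun i j => inner ℝ (e i) (e j) = 0)
    (hsum : Summable fun i => ‖e i‖ ^ 2) (x : UnitAddCircle) :
    Summable fun n => cas n x • e n := by
  refine summable_of_orthogonal (fun i j hij => ?_) ?_
  · simp only [inner_smul_left, inner_smul_right, horth hij, mul_zero]
  · refine (hsum.mul_left 4).of_nonneg_of_le (fun n => sq_nonneg _) fun n => ?_
    rw [norm_smul, mul_pow]
    gcongr
    rw [Real.norm_eq_abs]
    nlinarith [abs_cas_le n x, abs_nonneg (cas n x)]

/-- Orthogonal coefficients are recovered from the values of the random Fourier series. -/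
lemma mem_closure_span_tsum_cas (horth : Pairwise fun i j => inner ℝ (e i) (e j) = 0)
    (hsum : Summable fun i => ‖e i‖ ^ 2) (m : ℤ) :
    e m ∈ (Submodule.span ℝ (Set.range fun x => ∑' n, cas n x • e n)).topologicalClosure := by
  rw [← Submodule.orthogonal_orthogonal_eq_closure, Submodule.mem_orthogonal]
  intro y hy
  rw [real_inner_comm]
  refine eq_zero_of_hasSum_cas (b := fun n => inner ℝ (e n) y) (fun x => ?_) m
  have h := (summable_cas_smul horth hsum x).hasSum.mapL (innerSL ℝ y)
  have h0 : innerSL ℝ y (∑' n, cas n x • e n) = 0 := by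
    rw [innerSL_apply_apply, real_inner_comm]
    exact (Submodule.mem_orthogonal _ _).mp hy _ (Submodule.subset_span ⟨x, rfl⟩)
  rw [h0] at h
  refine h.congr_fun fun n => ?_
  rw [innerSL_apply_apply, inner_smul_right, real_inner_comm, mul_comm]

end Hilbert

/-! ### Limits and uniqueness of Gaussian laws -/

section Gaussian

variable {Ω : Type*} [MeasurableSpace Ω] {μ : Measure Ω}

section Closed

variable [IsProbabilityMeasure μ]

lemma integral_eq_inner_one (f : Lp ℝ 2 μ) : ∫ ω, f ω ∂μ =
    inner ℝ ((memLp_const (1 : ℝ)).toLp (fun _ : Ω => (1 : ℝ)) : Lp ℝ 2 μ) f := by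
  rw [L2.inner_def]
  refine integral_congr_ae ?_
  filter_upwards [(memLp_const (μ := μ) (p := 2) (1 : ℝ)).coeFn_toLp] with ω hω
  rw [hω]
  simp

lemma continuous_integral_Lp_two : Continuous fun f : Lp ℝ 2 μ => ∫ ω, f ω ∂μ := by
  simp only [integral_eq_inner_one]
  fun_prop

lemma continuous_integral_exp_Lp_two (t : ℝ) :
    Continuous fun f : Lp ℝ 2 μ => ∫ ω, Complex.exp (t * f ω * Complex.I) ∂μ := by
  have hint (f : Lp ℝ 2 μ) : Integrable (fun ω => Complex.exp (t * f ω * Complex.I)) μ := by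
    have hm : AEStronglyMeasurable (fun ω => Complex.exp (t * f ω * Complex.I)) μ := by
      have := Lp.aestronglyMeasurable f
      fun_prop
    refine Integrable.of_bound hm 1 (.of_forall fun ω => ?_)
    rw [← Complex.ofReal_mul, Complex.norm_exp_ofReal_mul_I]
  refine (LipschitzWith.of_dist_le_mul (K := ‖t‖₊) fun f g => ?_).continuous
  rw [dist_eq_norm, dist_eq_norm, ← integral_sub (hint f) (hint g)]
  have hb (ω : Ω) : ‖Complex.exp (t * f ω * Complex.I) - Complex.exp (t * g ω * Complex.I)‖ ≤
      |t| * |f ω - g ω| := by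
    have h1 : Complex.exp (t * f ω * Complex.I) - Complex.exp (t * g ω * Complex.I) =
        Complex.exp ((t * g ω : ℝ) * Complex.I) *
          (Complex.exp (Complex.I * (t * (f ω - g ω) : ℝ)) - 1) := by
      rw [mul_sub, ← Complex.exp_add]
      push_cast
      ring_nf
    rw [h1, norm_mul, Complex.norm_exp_ofReal_mul_I, one_mul, ← abs_mul]
    exact Real.norm_exp_I_mul_ofReal_sub_one_le
  have hfg : Integrable (fun ω => |f ω - g ω|) μ :=
    (((Lp.memLp f).sub (Lp.memLp g)).integrable one_le_two).abs
  calc _ ≤ ∫ ω, ‖Complex.exp (t * f ω * Complex.I) - Complex.exp (t * g ω * Complex.I)‖ ∂μ :=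
        norm_integral_le_integral_norm _
    _ ≤ ∫ ω, |t| * |f ω - g ω| ∂μ :=
        integral_mono ((hint f).sub (hint g)).norm (hfg.const_mul _) hb
    _ = |t| * ∫ ω, |f ω - g ω| ∂μ := integral_const_mul _ _
    _ ≤ |t| * ‖f - g‖ := by
        gcongr
        have h1 : ∫ ω, |f ω - g ω| ∂μ = (eLpNorm (f - g : Lp ℝ 2 μ) 1 μ).toReal := by
          rw [eLpNorm_congr_ae (Lp.coeFn_sub f g), eLpNorm_one_eq_lintegral_enorm,
            ← integral_norm_eq_lintegral_enorm
              ((Lp.aestronglyMeasurable f).sub (Lp.aestronglyMeasurable g))]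
          rfl
        rw [h1, Lp.norm_def]
        exact ENNReal.toReal_mono (Lp.eLpNorm_ne_top _)
          (eLpNorm_le_eLpNorm_of_exponent_le one_le_two (Lp.aestronglyMeasurable _))
    _ = _ := by simp

/-- Gaussian variables form a closed subset of `L²`, because mean, variance and characteristic
function are continuous there. -/
lemma isClosed_hasGaussianLaw : IsClosed {f : Lp ℝ 2 μ | HasGaussianLaw f μ} := by
  have hvar (f : Lp ℝ 2 μ) (t : ℝ) : Var[fun ω => inner ℝ t (f ω); μ] =
      t ^ 2 * (‖f‖ ^ 2 - (∫ ω, f ω ∂μ) ^ 2) := by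
    have h1 : (fun ω => inner ℝ t (f ω)) = fun ω => t * f ω := by
      funext ω; simp [mul_comm]
    have h2 : ∫ ω, (f ω) ^ 2 ∂μ = ‖f‖ ^ 2 := by
      rw [← real_inner_self_eq_norm_sq, L2.inner_def]
      simp [pow_two]
    rw [h1, variance_const_mul, variance_eq_sub (Lp.memLp f), ← h2]
    rfl
  have hmean (f : Lp ℝ 2 μ) (t : ℝ) : ∫ ω, inner ℝ t (f ω) ∂μ = t * ∫ ω, f ω ∂μ := by
    rw [← integral_const_mul]
    simp [mul_comm]
  have hchar (f : Lp ℝ 2 μ) (t : ℝ) : charFun (μ.map f) t =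
      ∫ ω, Complex.exp (t * f ω * Complex.I) ∂μ := by
    rw [charFun_apply_real, integral_map (Lp.aestronglyMeasurable f).aemeasurable (by fun_prop)]
  have hset : {f : Lp ℝ 2 μ | HasGaussianLaw f μ} = ⋂ t : ℝ, {f : Lp ℝ 2 μ |
      ∫ ω, Complex.exp (t * f ω * Complex.I) ∂μ =
        Complex.exp ((t * ∫ ω, f ω ∂μ : ℝ) * Complex.I -
          (t ^ 2 * (‖f‖ ^ 2 - (∫ ω, f ω ∂μ) ^ 2) : ℝ) / 2)} := by
    ext f
    simp only [Set.mem_ofPred_eq, Set.mem_iInter]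
    rw [hasGaussianLaw_iff_charFun_map_eq (Lp.aestronglyMeasurable f).aemeasurable]
    simp only [hvar, hmean, hchar]
  rw [hset]
  refine isClosed_iInter fun t => isClosed_eq (continuous_integral_exp_Lp_two t) ?_
  have := continuous_integral_Lp_two (μ := μ)
  fun_prop

end Closed

lemma strongDual_pi_apply {I : Type*} [Fintype I] [DecidableEq I] (L : StrongDual ℝ (I → ℝ))
    (z : I → ℝ) : L z = ∑ i, L (Pi.single i 1) * z i := by
  conv_lhs => rw [← Finset.univ_sum_single z, map_sum]
  refine Finset.sum_congr rfl fun i _ => ?_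
  rw [show (Pi.single i (z i) : I → ℝ) = z i • Pi.single i 1 by
    rw [← Pi.single_smul, smul_eq_mul, mul_one], map_smul, smul_eq_mul, mul_comm]

lemma isGaussianProcess_of_forall_sum {T : Type*} {X : T → Ω → ℝ} (hX : ∀ t, Measurable (X t))
    (h : ∀ (I : Finset T) (c : I → ℝ), HasGaussianLaw (fun ω => ∑ i, c i * X i ω) μ) :
    IsGaussianProcess X μ where
  hasGaussianLaw I := by
    classical
    have hm : Measurable fun ω => I.restrict (X · ω) := measurable_pi_lambda _ fun i => hX i
    refine ⟨isGaussian_of_isGaussian_map fun L => ?_⟩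
    rw [Measure.map_map (by fun_prop) hm]
    have : (L ∘ fun ω => I.restrict (X · ω)) = fun ω => ∑ i, L (Pi.single i 1) * X i ω :=
      funext fun ω => strongDual_pi_apply L _
    rw [this]
    exact (h I fun i => L (Pi.single i 1)).isGaussian_map

end Gaussian

/-- A centred Gaussian law on path space is determined by its covariance function. -/
lemma IsCenteredGaussianLaw.unique {k : UnitAddCircle → UnitAddCircle → ℝ}
    {P Q : Measure (UnitAddCircle → ℝ)} (hP : IsCenteredGaussianLaw k P)
    (hQ : IsCenteredGaussianLaw k Q) : P = Q := by
  have hprob {P : Measure (UnitAddCircle → ℝ)} (hP : IsCenteredGaussianLaw k P) :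
      IsProbabilityMeasure P := hP.gaussian.isProbabilityMeasure
  have := hprob hP
  have := hprob hQ
  have hchar {P : Measure (UnitAddCircle → ℝ)} (hP : IsCenteredGaussianLaw k P)
      (I : Finset UnitAddCircle) (L : StrongDual ℝ (I → ℝ)) :
      charFunDual (P.map I.restrict) L = Complex.exp (-((∑ i, ∑ j,
        L (Pi.single j 1) * (L (Pi.single i 1) * k i j) : ℝ) : ℂ) / 2) := by
    have := hprob hP
    have hlaw : HasGaussianLaw (fun z : UnitAddCircle → ℝ => I.restrict z) P :=
      hP.gaussian.hasGaussianLaw I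
    have hmem (i : I) : MemLp (fun z : UnitAddCircle → ℝ => z i) 2 P :=
      (hP.gaussian.hasGaussianLaw_eval i).memLp_two
    have hL : (L ∘ fun z : UnitAddCircle → ℝ => I.restrict z) =
        fun z => ∑ i : I, L (Pi.single i 1) * z i := funext fun z => strongDual_pi_apply L _
    have h := hlaw.charFunDual_map_eq L
    rw [hL, integral_finsetSum _ fun i _ => ((hmem i).integrable one_le_two).const_mul _,
      variance_fun_sum fun i => (hmem i).const_mul _] at h
    simp only [integral_const_mul, hP.mean_zero, mul_zero, Finset.sum_const_zero,
      Complex.ofReal_zero, zero_mul, covariance_const_mul_left, covariance_const_mul_right,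
      hP.covariance_eq] at h
    rw [show (I.restrict : (UnitAddCircle → ℝ) → (I → ℝ)) = fun z => I.restrict z from rfl, h]
    congr 1
    ring
  refine IsProjectiveLimit.unique (P := fun I => P.map I.restrict) (fun I => rfl) fun I => ?_
  have := (Measure.isProbabilityMeasure_map (μ := P) (f := I.restrict)
    (Finset.measurable_restrict I).aemeasurable)
  have := (Measure.isProbabilityMeasure_map (μ := Q) (f := I.restrict)
    (Finset.measurable_restrict I).aemeasurable)
  refine Measure.ext_of_charFunDual (funext fun L => ?_)
  rw [hchar hP, hchar hQ]

/-! ### Random Fourier series -/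

lemma map_coord_gaussianSeq {ι : Type*} (v : ι → ℝ≥0) (i : ι) :
    (gaussianSeq v).map (fun a => a i) = gaussianReal 0 (v i) :=
  Measure.infinitePi_map_eval _ i

lemma hasGaussianLaw_coord {ι : Type*} (v : ι → ℝ≥0) (i : ι) :
    HasGaussianLaw (fun a : ι → ℝ => a i) (gaussianSeq v) :=
  ⟨by rw [map_coord_gaussianSeq]; infer_instance⟩

lemma memLp_coord {ι : Type*} (v : ι → ℝ≥0) (i : ι) :
    MemLp (fun a : ι → ℝ => a i) 2 (gaussianSeq v) := (hasGaussianLaw_coord v i).memLp_two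

lemma iIndepFun_coord {ι : Type*} (v : ι → ℝ≥0) :
    iIndepFun (fun (i : ι) (a : ι → ℝ) => a i) (gaussianSeq v) :=
  iIndepFun_infinitePi (X := fun _ (y : ℝ) => y) fun _ => measurable_id

lemma integral_coord {ι : Type*} (v : ι → ℝ≥0) (i : ι) : ∫ a, a i ∂(gaussianSeq v) = 0 := by
  have h := integral_map (μ := gaussianSeq v) (φ := fun a => a i) (f := fun y : ℝ => y)
    (measurable_pi_apply i).aemeasurable (by fun_prop)
  rw [← h, map_coord_gaussianSeq, integral_id_gaussianReal]

lemma integral_coord_mul_coord {ι : Type*} [DecidableEq ι] (v : ι → ℝ≥0) (i j : ι) :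
    ∫ a, a i * a j ∂(gaussianSeq v) = if i = j then (v i : ℝ) else 0 := by
  split_ifs with h
  · subst h
    have h := variance_eq_sub (memLp_coord v i)
    have hvar : Var[fun a : ι → ℝ => a i; gaussianSeq v] = v i := by
      rw [← variance_fun_id_gaussianReal (μ := 0) (v := v i), ← map_coord_gaussianSeq,
        variance_map (X := fun x : ℝ => x) (Y := fun a : ι → ℝ => a i)
          measurable_id.aemeasurable (measurable_pi_apply i).aemeasurable]
      rfl
    rw [hvar, integral_coord] at h
    simpa [pow_two] using h.symm
  · have := ((iIndepFun_coord v).indepFun h).integral_mul_eq_mul_integral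
      (memLp_coord v i).1 (memLp_coord v j).1
    rw [integral_coord, zero_mul] at this
    exact this

/-- Restriction of square integrable functions to a smaller measure. -/
noncomputable def lpMono {Ω : Type*} [MeasurableSpace Ω] {μ ρ : Measure Ω} (h : μ ≤ ρ) :
    Lp ℝ 2 ρ →L[ℝ] Lp ℝ 2 μ :=
  LinearMap.mkContinuous
    { toFun := fun f => ((Lp.memLp f).mono_measure h).toLp f
      map_add' := fun f g => by
        rw [← MemLp.toLp_add]
        exact MemLp.toLp_congr _ _ (ae_mono h (Lp.coeFn_add f g))
      map_smul' := fun c f => by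
        rw [RingHom.id_apply, ← MemLp.toLp_const_smul]
        exact MemLp.toLp_congr _ _ (ae_mono h (Lp.coeFn_smul c f)) }
    1 fun f => by
      rw [one_mul, LinearMap.coe_mk, AddHom.coe_mk, Lp.norm_toLp, Lp.norm_def]
      exact ENNReal.toReal_mono (Lp.eLpNorm_ne_top f) (eLpNorm_mono_measure _ h)

lemma coeFn_lpMono {Ω : Type*} [MeasurableSpace Ω] {μ ρ : Measure Ω} (h : μ ≤ ρ) (f : Lp ℝ 2 ρ) :
    lpMono h f =ᵐ[μ] f :=
  ((Lp.memLp f).mono_measure h).coeFn_toLp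

/-- The coordinates of a random sequence, as elements of `L²`. -/
noncomputable def coordLp {ρ : Measure (ℤ → ℝ)} (hL : ∀ n : ℤ, MemLp (fun a : ℤ → ℝ => a n) 2 ρ)
    (n : ℤ) : Lp ℝ 2 ρ := (hL n).toLp _

lemma lpMono_coordLp {μ ρ : Measure (ℤ → ℝ)} (h : μ ≤ ρ)
    (hL : ∀ n : ℤ, MemLp (fun a : ℤ → ℝ => a n) 2 ρ)
    (hL' : ∀ n : ℤ, MemLp (fun a : ℤ → ℝ => a n) 2 μ) (n : ℤ) :
    lpMono h (coordLp hL n) = coordLp hL' n :=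
  MemLp.toLp_congr ((Lp.memLp _).mono_measure h) (hL' n) (ae_mono h (hL n).coeFn_toLp)

lemma inner_coordLp {ρ : Measure (ℤ → ℝ)} (hL : ∀ n : ℤ, MemLp (fun a : ℤ → ℝ => a n) 2 ρ)
    (n m : ℤ) : inner ℝ (coordLp hL n) (coordLp hL m) = ∫ a, a n * a m ∂ρ := by
  rw [L2.inner_def]
  refine integral_congr_ae ?_
  filter_upwards [(hL n).coeFn_toLp, (hL m).coeFn_toLp] with a h1 h2
  simp only [coordLp, h1, h2]
  simp [mul_comm]

/-- The sum of the random Fourier series with the coordinates as coefficients, in `L²`. -/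
noncomputable def seriesLp {ρ : Measure (ℤ → ℝ)} (hL : ∀ n : ℤ, MemLp (fun a : ℤ → ℝ => a n) 2 ρ)
    (x : UnitAddCircle) : Lp ℝ 2 ρ := ∑' n, cas n x • coordLp hL n

/-- The path of the random Fourier series, as a measurable function of the coefficients.  It is
assembled from representatives of the `L²` classes, one for each point of the circle. -/
noncomputable def seriesPath {ρ : Measure (ℤ → ℝ)} (hL : ∀ n : ℤ, MemLp (fun a : ℤ → ℝ => a n) 2 ρ)
    (a : ℤ → ℝ) (x : UnitAddCircle) : ℝ := seriesLp hL x a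

lemma measurable_seriesPath {ρ : Measure (ℤ → ℝ)}
    (hL : ∀ n : ℤ, MemLp (fun a : ℤ → ℝ => a n) 2 ρ) : Measurable (seriesPath hL) :=
  measurable_pi_lambda _ fun x => (Lp.stronglyMeasurable (seriesLp hL x)).measurable

section SingleLaw

variable {v : ℤ → ℝ≥0}

lemma coordLp_orthogonal (v : ℤ → ℝ≥0) :
    Pairwise fun i j => inner ℝ (coordLp (memLp_coord v) i) (coordLp (memLp_coord v) j) = 0 :=
  fun i j hij => by
    change inner ℝ (coordLp (memLp_coord v) i) (coordLp (memLp_coord v) j) = 0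
    rw [inner_coordLp, integral_coord_mul_coord, if_neg hij]

lemma coordLp_norm_sq (v : ℤ → ℝ≥0) (n : ℤ) : ‖coordLp (memLp_coord v) n‖ ^ 2 = v n := by
  rw [← real_inner_self_eq_norm_sq, inner_coordLp, integral_coord_mul_coord, if_pos rfl]

lemma hasSum_seriesLp (hv : Summable v) (x : UnitAddCircle) :
    HasSum (fun n => cas n x • coordLp (memLp_coord v) n) (seriesLp (memLp_coord v) x) := by
  refine (summable_cas_smul (coordLp_orthogonal v) ?_ x).hasSum
  simp only [coordLp_norm_sq]
  exact_mod_cast hv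

lemma integral_seriesLp (hv : Summable v) (x : UnitAddCircle) :
    ∫ a, seriesLp (memLp_coord v) x a ∂(gaussianSeq v) = 0 := by
  rw [integral_eq_inner_one]
  refine ((hasSum_seriesLp hv x).mapL (innerSL ℝ _)).unique ?_
  have h0 (n : ℤ) : innerSL ℝ ((memLp_const (1 : ℝ)).toLp (fun _ : ℤ → ℝ => (1 : ℝ)) :
      Lp ℝ 2 (gaussianSeq v)) (cas n x • coordLp (memLp_coord v) n) = 0 := by
    rw [innerSL_apply_apply, inner_smul_right, ← integral_eq_inner_one]
    have : ∫ a, coordLp (memLp_coord v) n a ∂(gaussianSeq v) = ∫ a, a n ∂(gaussianSeq v) :=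
      integral_congr_ae (memLp_coord v n).coeFn_toLp
    rw [this, integral_coord, mul_zero]
  simp only [h0]
  exact hasSum_zero

lemma inner_seriesLp (hv : Summable v) (x y : UnitAddCircle) :
    inner ℝ (seriesLp (memLp_coord v) x) (seriesLp (memLp_coord v) y) =
      ∑' n, (v n : ℝ) * (cas n x * cas n y) := by
  have h1 (n : ℤ) : inner ℝ (seriesLp (memLp_coord v) x) (coordLp (memLp_coord v) n) =
      cas n x * v n := by
    rw [real_inner_comm]
    refine ((hasSum_seriesLp hv x).mapL (innerSL ℝ _)).unique ?_
    have := hasSum_single (f := fun m => innerSL ℝ (coordLp (memLp_coord v) n)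
      (cas m x • coordLp (memLp_coord v) m)) n fun m hm => by
        rw [innerSL_apply_apply, inner_smul_right, coordLp_orthogonal v hm.symm, mul_zero]
    rwa [innerSL_apply_apply, inner_smul_right, real_inner_self_eq_norm_sq, coordLp_norm_sq] at this
  have h2 := (hasSum_seriesLp hv y).mapL (innerSL ℝ (seriesLp (memLp_coord v) x))
  simp only [innerSL_apply_apply, inner_smul_right, h1] at h2
  rw [← h2.tsum_eq]
  exact tsum_congr fun n => by ring

lemma hasGaussianLaw_of_mem_span {f : Lp ℝ 2 (gaussianSeq v)}
    (hf : f ∈ Submodule.span ℝ (Set.range (coordLp (memLp_coord v)))) :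
    HasGaussianLaw f (gaussianSeq v) := by
  obtain ⟨c, rfl⟩ := Finsupp.mem_span_range_iff_exists_finsupp.mp hf
  have hind : iIndepFun (fun (i : c.support) (a : ℤ → ℝ) => c i * a i) (gaussianSeq v) :=
    ((iIndepFun_coord v).precomp Subtype.val_injective).comp
      (fun (i : c.support) y => c i * y)
      fun i => by fun_prop
  have hG := hind.hasGaussianLaw_fun_sum
    fun i : c.support => (hasGaussianLaw_coord v (i : ℤ)).fun_smul (c i)
  refine hG.congr ?_
  have hcoe : ∀ᵐ a ∂(gaussianSeq v), ∀ n, coordLp (memLp_coord v) n a = a n :=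
    ae_all_iff.mpr fun n => (memLp_coord v n).coeFn_toLp
  have hsmul : ∀ᵐ a ∂(gaussianSeq v), ∀ n,
      (c n • coordLp (memLp_coord v) n : Lp ℝ 2 (gaussianSeq v)) a =
        c n * coordLp (memLp_coord v) n a :=
    ae_all_iff.mpr fun n => Lp.coeFn_smul _ _
  filter_upwards [hcoe, hsmul, Lp.coeFn_finsetSum c.support
    fun n => c n • coordLp (memLp_coord v) n] with a h1 h2 h3
  rw [Finsupp.sum, h3, Finset.sum_apply]
  simp only [h1, h2]
  exact Finset.sum_coe_sort c.support fun n => c n * a n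

lemma hasGaussianLaw_of_mem_closure_span {f : Lp ℝ 2 (gaussianSeq v)}
    (hf : f ∈ (Submodule.span ℝ (Set.range (coordLp (memLp_coord v)))).topologicalClosure) :
    HasGaussianLaw f (gaussianSeq v) :=
  closure_minimal (fun _ hg => hasGaussianLaw_of_mem_span hg) isClosed_hasGaussianLaw hf

lemma seriesLp_mem_closure_span (hv : Summable v) (x : UnitAddCircle) :
    seriesLp (memLp_coord v) x ∈
      (Submodule.span ℝ (Set.range (coordLp (memLp_coord v)))).topologicalClosure :=
  mem_closure_of_tendsto (hasSum_seriesLp hv x) (.of_forall fun _ =>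
    Submodule.sum_mem _ fun n _ => Submodule.smul_mem _ _ (Submodule.subset_span ⟨n, rfl⟩))

end SingleLaw

/-- The path of the random Fourier series has the centred Gaussian law with the covariance of the
series.  The path map may be built from any measure `ρ` above the law of the coefficients, which
allows one map to serve two laws. -/
lemma isCenteredGaussianLaw_map_seriesPath {v : ℤ → ℝ≥0} (hv : Summable v) {ρ : Measure (ℤ → ℝ)}
    (hρ : gaussianSeq v ≤ ρ) (hL : ∀ n : ℤ, MemLp (fun a : ℤ → ℝ => a n) 2 ρ)
    (hs : ∀ x, Summable fun n => cas n x • coordLp hL n) :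
    IsCenteredGaussianLaw (fun x y => ∑' n, (v n : ℝ) * (cas n x * cas n y))
      ((gaussianSeq v).map (seriesPath hL)) := by
  have hm := measurable_seriesPath hL
  have hZ (x : UnitAddCircle) :
      (fun a => seriesPath hL a x) =ᵐ[gaussianSeq v] seriesLp (memLp_coord v) x := by
    have h1 : lpMono hρ (seriesLp hL x) = seriesLp (memLp_coord v) x := by
      rw [seriesLp, (lpMono hρ).map_tsum (hs x), seriesLp]
      refine tsum_congr fun n => ?_
      rw [map_smul, lpMono_coordLp hρ hL (memLp_coord v)]
    rw [← h1]
    exact (coeFn_lpMono hρ _).symm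
  have hmem (x : UnitAddCircle) : MemLp (fun a => seriesPath hL a x) 2 (gaussianSeq v) :=
    (memLp_congr_ae (hZ x)).mpr (Lp.memLp _)
  have hmean (x : UnitAddCircle) : ∫ a, seriesPath hL a x ∂(gaussianSeq v) = 0 := by
    rw [integral_congr_ae (hZ x), integral_seriesLp hv]
  refine ⟨isGaussianProcess_of_forall_sum (fun x => measurable_pi_apply x) fun I c => ⟨?_⟩,
    fun x => ?_, fun x y => ?_⟩
  · rw [Measure.map_map (by fun_prop) hm]
    have hG : HasGaussianLaw (∑ i : I, c i • seriesLp (memLp_coord v) i : Lp ℝ 2 (gaussianSeq v))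
        (gaussianSeq v) :=
      hasGaussianLaw_of_mem_closure_span (Submodule.sum_mem _ fun i _ =>
        Submodule.smul_mem _ _ (seriesLp_mem_closure_span hv i))
    refine (hG.congr ?_).isGaussian_map
    have h1 : ∀ᵐ a ∂(gaussianSeq v), ∀ i : I, seriesPath hL a i =
        seriesLp (memLp_coord v) i a := ae_all_iff.mpr fun i => hZ i
    have h2 : ∀ᵐ a ∂(gaussianSeq v), ∀ i : I,
        (c i • seriesLp (memLp_coord v) i : Lp ℝ 2 (gaussianSeq v)) a =
          c i * seriesLp (memLp_coord v) i a := ae_all_iff.mpr fun i => Lp.coeFn_smul _ _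
    filter_upwards [h1, h2, Lp.coeFn_finsetSum Finset.univ
      fun i : I => c i • seriesLp (memLp_coord v) i] with a h1 h2 h3
    rw [h3, Finset.sum_apply]
    simp only [h2, Function.comp_apply, h1]
  · rw [integral_map hm.aemeasurable (measurable_pi_apply x).aestronglyMeasurable, hmean]
  · rw [covariance_map_fun (measurable_pi_apply x).aestronglyMeasurable
      (measurable_pi_apply y).aestronglyMeasurable hm.aemeasurable,
      covariance_eq_sub (hmem x) (hmem y), hmean, zero_mul, sub_zero, ← inner_seriesLp hv,
      L2.inner_def]
    refine integral_congr_ae ?_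
    filter_upwards [hZ x, hZ y] with a h1 h2
    simp only [Pi.mul_apply, h1, h2]
    simp [mul_comm]

/-- The coefficients of the random Fourier series are almost surely measurable functions of the
path. -/
lemma exists_measurable_leftInverse_seriesPath {ρ : Measure (ℤ → ℝ)}
    (hL : ∀ n : ℤ, MemLp (fun a : ℤ → ℝ => a n) 2 ρ)
    (horth : Pairwise fun i j => inner ℝ (coordLp hL i) (coordLp hL j) = 0)
    (hsum : Summable fun i => ‖coordLp hL i‖ ^ 2) :
    ∃ Ψ : (UnitAddCircle → ℝ) → ℤ → ℝ, Measurable Ψ ∧ ∀ᵐ a ∂ρ, Ψ (seriesPath hL a) = a := by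
  have hm := (measurable_seriesPath hL).comap_le
  have hV : (Submodule.span ℝ (Set.range (seriesLp hL))).topologicalClosure ≤
      lpMeas ℝ ℝ (MeasurableSpace.pi.comap (seriesPath hL)) 2 ρ := by
    refine Submodule.topologicalClosure_minimal _ (Submodule.span_le.mpr ?_)
      (isClosed_aestronglyMeasurable hm)
    rintro _ ⟨x, rfl⟩
    have h1 : Measurable[MeasurableSpace.pi.comap (seriesPath hL)] fun a => seriesPath hL a x :=
      (measurable_pi_apply x).comp (comap_measurable (seriesPath hL))
    exact mem_lpMeas_iff_aestronglyMeasurable.mpr (h1.stronglyMeasurable.aestronglyMeasurable)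
  have hn (n : ℤ) : ∃ G : (UnitAddCircle → ℝ) → ℝ, Measurable G ∧
      ∀ᵐ a ∂ρ, G (seriesPath hL a) = a n := by
    have h1 : AEStronglyMeasurable[MeasurableSpace.pi.comap (seriesPath hL)]
        (coordLp hL n) ρ :=
      mem_lpMeas_iff_aestronglyMeasurable.mp (hV (mem_closure_span_tsum_cas horth hsum n))
    obtain ⟨g, hg, hge⟩ := h1
    obtain ⟨G, hG, rfl⟩ := hg.measurable.exists_eq_measurable_comp
    refine ⟨G, hG, ?_⟩
    filter_upwards [hge, (hL n).coeFn_toLp] with a h1 h2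
    rw [← h2]
    exact h1.symm
  choose G hG hGe using hn
  refine ⟨fun z n => G n z, measurable_pi_lambda _ hG, ?_⟩
  filter_upwards [ae_all_iff.mpr hGe] with a ha
  exact funext ha

/-- A common representation of two centred Gaussian laws with summable spectra: one measurable map
`Φ` sends coefficient sequences to paths, and one measurable map `Ψ` recovers the coefficients. -/
theorem exists_representation {v w : ℤ → ℝ≥0} (hv : Summable v) (hw : Summable w) :
    ∃ (Φ : (ℤ → ℝ) → UnitAddCircle → ℝ) (Ψ : (UnitAddCircle → ℝ) → ℤ → ℝ),
      Measurable Φ ∧ Measurable Ψ ∧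
      (IsCenteredGaussianLaw (fun x y => ∑' n, (v n : ℝ) * (cas n x * cas n y))
        ((gaussianSeq v).map Φ)) ∧
      (IsCenteredGaussianLaw (fun x y => ∑' n, (w n : ℝ) * (cas n x * cas n y))
        ((gaussianSeq w).map Φ)) ∧
      (∀ᵐ a ∂(gaussianSeq v), Ψ (Φ a) = a) ∧ ∀ᵐ a ∂(gaussianSeq w), Ψ (Φ a) = a := by
  have hL (n : ℤ) : MemLp (fun a : ℤ → ℝ => a n) 2 (gaussianSeq v + gaussianSeq w) := by
    rw [memLp_two_iff_integrable_sq (measurable_pi_apply n).aestronglyMeasurable]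
    exact (memLp_coord v n).integrable_sq.add_measure (memLp_coord w n).integrable_sq
  have hinner (n m : ℤ) : inner ℝ (coordLp hL n) (coordLp hL m) =
      (if n = m then (v n : ℝ) else 0) + if n = m then (w n : ℝ) else 0 := by
    have hint (u : ℤ → ℝ≥0) : Integrable (fun a : ℤ → ℝ => a n * a m) (gaussianSeq u) :=
      (memLp_coord u n).integrable_mul (memLp_coord u m)
    rw [inner_coordLp, integral_add_measure (hint v) (hint w), integral_coord_mul_coord,
      integral_coord_mul_coord]
  have horth : Pairwise fun i j => inner ℝ (coordLp hL i) (coordLp hL j) = 0 :=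
    fun i j hij => by simp [hinner, hij]
  have hsum : Summable fun i => ‖coordLp hL i‖ ^ 2 := by
    simp only [← real_inner_self_eq_norm_sq, hinner, if_true]
    exact_mod_cast hv.add hw
  obtain ⟨Ψ, hΨ, hae⟩ := exists_measurable_leftInverse_seriesPath hL horth hsum
  have hlev : gaussianSeq v ≤ gaussianSeq v + gaussianSeq w := Measure.le_add_right le_rfl
  have hlew : gaussianSeq w ≤ gaussianSeq v + gaussianSeq w := Measure.le_add_left le_rfl
  exact ⟨seriesPath hL, Ψ, measurable_seriesPath hL, hΨ,
    isCenteredGaussianLaw_map_seriesPath hv hlev hL (summable_cas_smul horth hsum),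
    isCenteredGaussianLaw_map_seriesPath hw hlew hL (summable_cas_smul horth hsum),
    ae_mono hlev hae, ae_mono hlew hae⟩

/-! ### Equivalence of Matérn measures -/

/-- The spectral weights at smoothness `1 / 2 + s`, as nonnegative reals. -/
noncomputable def nnWeight (s : ℕ) (α : ℝ) (n : ℤ) : ℝ≥0 :=
  (spectralWeight (1 / 2 + (s : ℝ)) α n).toNNReal

/-- The microergodic parameter: the factor `σ² / ∑ₙ (α² + 4 π² n²) ^ (-s - 1)` in front of the
spectral weights. -/
noncomputable def spectralScale (s : ℕ) (σ α : ℝ) : ℝ≥0 := (σ ^ 2 / totalWeight s α).toNNReal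

lemma coe_nnWeight {α : ℝ} (hα : 0 < α) (s : ℕ) (n : ℤ) :
    (nnWeight s α n : ℝ) = spectralWeight (1 / 2 + (s : ℝ)) α n :=
  Real.coe_toNNReal _ (spectralWeight_pos hα _ n).le

lemma coe_spectralScale {α : ℝ} (hα : 0 < α) (s : ℕ) (σ : ℝ) :
    (spectralScale s σ α : ℝ) = σ ^ 2 / totalWeight s α :=
  Real.coe_toNNReal _ (div_nonneg (sq_nonneg σ) (totalWeight_pos hα s).le)

lemma nnWeight_ne_zero {α : ℝ} (hα : 0 < α) (s : ℕ) (n : ℤ) : nnWeight s α n ≠ 0 :=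
  (Real.toNNReal_pos.mpr (spectralWeight_pos hα _ n)).ne'

lemma spectralScale_ne_zero {σ α : ℝ} (hσ : 0 < σ) (hα : 0 < α) (s : ℕ) :
    spectralScale s σ α ≠ 0 := by
  have := totalWeight_pos hα s
  exact (Real.toNNReal_pos.mpr (by positivity)).ne'

lemma summable_variances {α : ℝ} (hα : 0 < α) (s : ℕ) (c : ℝ≥0) :
    Summable fun n => c * nnWeight s α n := by
  refine Summable.mul_left c ?_
  rw [← NNReal.summable_coe]
  simpa only [coe_nnWeight hα] using summable_spectralWeight hα s

lemma covariogram_eq_tsum_cas {α : ℝ} (hα : 0 < α) (s : ℕ) (σ : ℝ) :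
    covariogram (1 / 2 + (s : ℝ)) σ α = fun x y =>
      ∑' n, ((spectralScale s σ α * nnWeight s α n : ℝ≥0) : ℝ) * (cas n x * cas n y) := by
  funext x y
  simp only [NNReal.coe_mul, coe_nnWeight hα, coe_spectralScale hα, mul_assoc]
  rw [tsum_mul_left, tsum_mul_cas_mul_cas (summable_spectralWeight hα s)
    fun n => by simp [spectralWeight]]
  rfl

/-- Absolute continuity passes from coefficients to paths by `Φ`, and from paths to coefficients by
the almost sure inverse `Ψ` of `exists_representation`. -/
lemma absolutelyContinuous_iff_gaussianSeq (s : ℕ) {σ₁ α₁ σ₂ α₂ : ℝ} (hα₁ : 0 < α₁) (hα₂ : 0 < α₂)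
    {P₁ P₂ : Measure (UnitAddCircle → ℝ)} (hP₁ : IsMaternMeasure (1 / 2 + (s : ℝ)) σ₁ α₁ P₁)
    (hP₂ : IsMaternMeasure (1 / 2 + (s : ℝ)) σ₂ α₂ P₂) :
    P₁ ≪ P₂ ↔ gaussianSeq (fun n => spectralScale s σ₁ α₁ * nnWeight s α₁ n) ≪
      gaussianSeq (fun n => spectralScale s σ₂ α₂ * nnWeight s α₂ n) := by
  rw [IsMaternMeasure, covariogram_eq_tsum_cas hα₁] at hP₁
  rw [IsMaternMeasure, covariogram_eq_tsum_cas hα₂] at hP₂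
  obtain ⟨Φ, Ψ, hΦ, hΨ, h₁, h₂, hinv₁, hinv₂⟩ := exists_representation
    (summable_variances hα₁ s (spectralScale s σ₁ α₁))
    (summable_variances hα₂ s (spectralScale s σ₂ α₂))
  rw [hP₁.unique h₁, hP₂.unique h₂]
  refine ⟨fun h => ?_, fun h => h.map hΦ⟩
  have key {u : ℤ → ℝ≥0} (hu : ∀ᵐ a ∂(gaussianSeq u), Ψ (Φ a) = a) :
      ((gaussianSeq u).map Φ).map Ψ = gaussianSeq u := by
    rw [Measure.map_map hΨ hΦ]
    exact (Measure.map_congr hu).trans Measure.map_id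
  rw [← key hinv₁, ← key hinv₂]
  exact h.map hΨ

/-- Matérn measures exist for all parameters, so consistency is never a vacuous requirement. -/
lemma exists_isMaternMeasure (s : ℕ) (σ : ℝ) {α : ℝ} (hα : 0 < α) :
    ∃ P : Measure (UnitAddCircle → ℝ), IsMaternMeasure (1 / 2 + (s : ℝ)) σ α P := by
  obtain ⟨Φ, -, -, -, h, -⟩ := exists_representation
    (summable_variances hα s (spectralScale s σ α)) (summable_variances hα s (spectralScale s σ α))
  exact ⟨_, by rw [IsMaternMeasure, covariogram_eq_tsum_cas hα]; exact h⟩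

lemma summable_weight_ratio_sub_one {α₁ α₂ : ℝ} (hα₁ : 0 < α₁) (hα₂ : 0 < α₂) (s : ℕ) :
    Summable fun n => spectralWeight (1 / 2 + (s : ℝ)) α₁ n /
      spectralWeight (1 / 2 + (s : ℝ)) α₂ n - 1 := by
  set r : ℤ → ℝ := fun n => (α₂ ^ 2 + 4 * Real.pi ^ 2 * (n : ℝ) ^ 2) /
    (α₁ ^ 2 + 4 * Real.pi ^ 2 * (n : ℝ) ^ 2) with hr
  have hr1 (n : ℤ) : r n - 1 =
      (α₂ ^ 2 - α₁ ^ 2) * (α₁ ^ 2 + 4 * Real.pi ^ 2 * (n : ℝ) ^ 2)⁻¹ := by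
    have : α₁ ^ 2 + 4 * Real.pi ^ 2 * (n : ℝ) ^ 2 ≠ 0 := by positivity
    rw [hr]
    field_simp
    ring
  have hr0 (n : ℤ) : 0 ≤ r n := by positivity
  have hrM (n : ℤ) : r n ≤ 1 + α₂ ^ 2 / α₁ ^ 2 := by
    have h1 : (0 : ℝ) ≤ 4 * Real.pi ^ 2 * (n : ℝ) ^ 2 := by positivity
    simp only [hr]
    rw [add_div, add_comm]
    gcongr
    · exact div_le_one_of_le₀ (by nlinarith [sq_nonneg α₁]) (by positivity)
    · linarith
  have hs1 : Summable fun n => r n - 1 := by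
    simp only [hr1]
    exact (summable_inv_add_sq hα₁).mul_left _
  have hpow (k : ℕ) : Summable fun n => r n ^ k - 1 := by
    induction k with
    | zero => simp
    | succ k ih =>
      have h2 : Summable fun n => r n ^ k * (r n - 1) := by
        refine (hs1.abs.mul_left ((1 + α₂ ^ 2 / α₁ ^ 2) ^ k)).of_norm_bounded fun n => ?_
        rw [Real.norm_eq_abs, abs_mul, abs_of_nonneg (pow_nonneg (hr0 n) k)]
        gcongr
        exact hrM n
      refine (h2.add ih).congr fun n => ?_
      ring
  refine (hpow (s + 1)).congr fun n => ?_
  rw [spectralWeight_half, spectralWeight_half, hr, div_pow, inv_div_inv]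

lemma gaussianSeq_nnWeight_absolutelyContinuous {α₁ α₂ : ℝ} (hα₁ : 0 < α₁) (hα₂ : 0 < α₂) (s : ℕ)
    {c : ℝ≥0} (hc : c ≠ 0) : gaussianSeq (fun n => c * nnWeight s α₁ n) ≪
      gaussianSeq fun n => c * nnWeight s α₂ n := by
  refine gaussianSeq_absolutelyContinuous (fun n => mul_ne_zero hc (nnWeight_ne_zero hα₁ s n))
    (fun n => mul_ne_zero hc (nnWeight_ne_zero hα₂ s n)) ?_
  refine (summable_weight_ratio_sub_one hα₁ hα₂ s).congr fun n => ?_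
  have hc' : (c : ℝ) ≠ 0 := by exact_mod_cast hc
  rw [NNReal.coe_mul, NNReal.coe_mul, coe_nnWeight hα₁, coe_nnWeight hα₂,
    mul_div_mul_left _ _ hc']

/-- With equal factors the variances of the coefficients have summable relative deviations.  With
different factors, `α₂` can first be replaced by `α₁`, and the law of large numbers applies. -/
lemma absolutelyContinuous_iff_spectralScale_eq (s : ℕ) {σ₁ α₁ σ₂ α₂ : ℝ}
    (hα₁ : 0 < α₁) (hσ₂ : 0 < σ₂) (hα₂ : 0 < α₂) {P₁ P₂ : Measure (UnitAddCircle → ℝ)}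
    (hP₁ : IsMaternMeasure (1 / 2 + (s : ℝ)) σ₁ α₁ P₁)
    (hP₂ : IsMaternMeasure (1 / 2 + (s : ℝ)) σ₂ α₂ P₂) :
    P₁ ≪ P₂ ↔ spectralScale s σ₁ α₁ = spectralScale s σ₂ α₂ := by
  rw [absolutelyContinuous_iff_gaussianSeq s hα₁ hα₂ hP₁ hP₂]
  refine ⟨fun h => ?_, fun h => ?_⟩
  · exact eq_of_gaussianSeq_absolutelyContinuous (nnWeight_ne_zero hα₁ s)
      (h.trans (gaussianSeq_nnWeight_absolutelyContinuous hα₂ hα₁ s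
        (spectralScale_ne_zero hσ₂ hα₂ s)))
  · rw [h]
    exact gaussianSeq_nnWeight_absolutelyContinuous hα₁ hα₂ s (spectralScale_ne_zero hσ₂ hα₂ s)

lemma spectralScale_eq_normConst {α : ℝ} (hα : 0 < α) (s : ℕ) (σ : ℝ) :
    σ ^ 2 * α * Real.sinh (α / 2) / normConst s α =
      (2 * (4 * Real.pi ^ 2) ^ s)⁻¹ * spectralScale s σ α := by
  have hs : 0 < Real.sinh (α / 2) := Real.sinh_pos_iff.mpr (by positivity)
  have hW := totalWeight_pos hα s
  rw [normConst_eq hα, coe_spectralScale hα]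
  field_simp

lemma equivalent_iff (s : ℕ) {σ₁ α₁ σ₂ α₂ : ℝ} (hσ₁ : 0 < σ₁)
    (hα₁ : 0 < α₁) (hσ₂ : 0 < σ₂) (hα₂ : 0 < α₂) {P₁ P₂ : Measure (UnitAddCircle → ℝ)}
    (hP₁ : IsMaternMeasure (1 / 2 + (s : ℝ)) σ₁ α₁ P₁)
    (hP₂ : IsMaternMeasure (1 / 2 + (s : ℝ)) σ₂ α₂ P₂) :
    Equivalent P₁ P₂ ↔ σ₁ ^ 2 * α₁ * Real.sinh (α₁ / 2) / normConst s α₁ =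
      σ₂ ^ 2 * α₂ * Real.sinh (α₂ / 2) / normConst s α₂ := by
  rw [Equivalent, absolutelyContinuous_iff_spectralScale_eq s hα₁ hσ₂ hα₂ hP₁ hP₂,
    absolutelyContinuous_iff_spectralScale_eq s hα₂ hσ₁ hα₁ hP₂ hP₁,
    eq_comm (b := spectralScale s σ₁ α₁), and_self, spectralScale_eq_normConst hα₁,
    spectralScale_eq_normConst hα₂,
    mul_right_inj' (by positivity), NNReal.coe_inj]

/-! ### Parameters that cannot be estimated consistently -/

/-- Along a common subsequence both convergences hold almost surely under `P`. -/
lemma eq_of_tendstoInMeasure_of_absolutelyContinuous {Ω : Type*} [MeasurableSpace Ω]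
    {P Q : Measure Ω} [NeZero P] (hPQ : P ≪ Q) {T : ℕ → Ω → ℝ} {a b : ℝ}
    (ha : TendstoInMeasure P T atTop fun _ => a) (hb : TendstoInMeasure Q T atTop fun _ => b) :
    a = b := by
  obtain ⟨ns, hns, hQ⟩ := hb.exists_seq_tendsto_ae
  obtain ⟨ms, hms, hP⟩ := (ha.comp hns.tendsto_atTop).exists_seq_tendsto_ae
  obtain ⟨ω, h1, h2⟩ := (hP.and (hPQ.ae_le hQ)).exists
  exact tendsto_nhds_unique h1 (h2.comp hms.tendsto_atTop)

/-- A consistently estimable parameter depends only on the factor of the spectral weights. -/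
lemma IsConsistent.eq_of_spectralScale_eq {s : ℕ} {T : ℕ → (UnitAddCircle → ℝ) → ℝ}
    {g : ℝ → ℝ → ℝ} (hT : IsConsistent (1 / 2 + (s : ℝ)) T g) {σ₁ α₁ σ₂ α₂ : ℝ} (hσ₁ : 0 < σ₁)
    (hα₁ : 0 < α₁) (hσ₂ : 0 < σ₂) (hα₂ : 0 < α₂)
    (h : spectralScale s σ₁ α₁ = spectralScale s σ₂ α₂) : g σ₁ α₁ = g σ₂ α₂ := by
  obtain ⟨P₁, hP₁⟩ := exists_isMaternMeasure s σ₁ hα₁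
  obtain ⟨P₂, hP₂⟩ := exists_isMaternMeasure s σ₂ hα₂
  have : IsProbabilityMeasure P₁ := hP₁.gaussian.isProbabilityMeasure
  exact eq_of_tendstoInMeasure_of_absolutelyContinuous
    ((absolutelyContinuous_iff_spectralScale_eq s hα₁ hσ₂ hα₂ hP₁ hP₂).mpr h)
    (hT.2 σ₁ α₁ hσ₁ hα₁ P₁ hP₁) (hT.2 σ₂ α₂ hσ₂ hα₂ P₂ hP₂)

lemma totalWeight_lt {α β : ℝ} (hα : 0 < α) (hαβ : α < β) (s : ℕ) :
    totalWeight s β < totalWeight s α := by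
  have hlt (n : ℤ) :
      spectralWeight (1 / 2 + (s : ℝ)) β n < spectralWeight (1 / 2 + (s : ℝ)) α n := by
    rw [spectralWeight_half, spectralWeight_half]
    gcongr
  exact Summable.tsum_lt_tsum (fun n => (hlt n).le) (hlt 0)
    (summable_spectralWeight (hα.trans hαβ) s) (summable_spectralWeight hα s)

lemma spectralScale_sqrt_totalWeight {α : ℝ} (hα : 0 < α) (s : ℕ) :
    spectralScale s √(totalWeight s α) α = 1 := by
  rw [spectralScale, Real.sq_sqrt (totalWeight_pos hα s).le, div_self (totalWeight_pos hα s).ne',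
    Real.toNNReal_one]

end MaternCircle

theorem mainTheorem10 (s : ℕ) :
    (∀ σ α : ℝ, 0 < σ → 0 < α → ∀ x y : UnitAddCircle,
      MaternCircle.covariogram (1 / 2 + (s : ℝ)) σ α x y =
        σ ^ 2 / MaternCircle.normConst s α * MaternCircle.profile s α ‖x - y‖) ∧
    (∀ σ₁ α₁ σ₂ α₂ : ℝ, 0 < σ₁ → 0 < α₁ → 0 < σ₂ → 0 < α₂ →
      ∀ P₁ P₂ : MeasureTheory.Measure (UnitAddCircle → ℝ),
        MaternCircle.IsMaternMeasure (1 / 2 + (s : ℝ)) σ₁ α₁ P₁ →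
        MaternCircle.IsMaternMeasure (1 / 2 + (s : ℝ)) σ₂ α₂ P₂ →
        (MaternCircle.Equivalent P₁ P₂ ↔
          σ₁ ^ 2 * α₁ * Real.sinh (α₁ / 2) / MaternCircle.normConst s α₁ =
            σ₂ ^ 2 * α₂ * Real.sinh (α₂ / 2) / MaternCircle.normConst s α₂)) ∧
    (¬ ∃ T : ℕ → (UnitAddCircle → ℝ) → ℝ,
      MaternCircle.IsConsistent (1 / 2 + (s : ℝ)) T (fun σ _ => σ ^ 2)) ∧
    (¬ ∃ T : ℕ → (UnitAddCircle → ℝ) → ℝ,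
      MaternCircle.IsConsistent (1 / 2 + (s : ℝ)) T (fun _ α => α)) := by
  have hW (α : ℝ) (hα : 0 < α) : 0 < √(MaternCircle.totalWeight s α) :=
    Real.sqrt_pos.mpr (MaternCircle.totalWeight_pos hα s)
  -- With `σ² = totalWeight s α`, the microergodic parameter is `1` for every `α`.
  have hcons {T : ℕ → (UnitAddCircle → ℝ) → ℝ} {g : ℝ → ℝ → ℝ}
      (hT : MaternCircle.IsConsistent (1 / 2 + (s : ℝ)) T g) :
      g √(MaternCircle.totalWeight s 1) 1 = g √(MaternCircle.totalWeight s 2) 2 :=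
    hT.eq_of_spectralScale_eq (hW 1 one_pos) one_pos (hW 2 two_pos) two_pos
      ((MaternCircle.spectralScale_sqrt_totalWeight one_pos s).trans
        (MaternCircle.spectralScale_sqrt_totalWeight two_pos s).symm)
  refine ⟨fun σ α _ hα x y => MaternCircle.covariogram_eq_profile hα s σ x y,
    fun σ₁ α₁ σ₂ α₂ hσ₁ hα₁ hσ₂ hα₂ P₁ P₂ hP₁ hP₂ =>
      MaternCircle.equivalent_iff s hσ₁ hα₁ hσ₂ hα₂ hP₁ hP₂, ?_, ?_⟩
  · rintro ⟨T, hT⟩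
    have h := hcons hT
    simp only [Real.sq_sqrt (MaternCircle.totalWeight_pos one_pos s).le,
      Real.sq_sqrt (MaternCircle.totalWeight_pos two_pos s).le] at h
    exact (MaternCircle.totalWeight_lt one_pos one_lt_two s).ne' h
  · rintro ⟨T, hT⟩
    have h := hcons hT
    norm_num at h
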